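/- **Theorem 5.2.** Let $M$ be a smooth, connected, Hausdorff, paracompact manifold without boundary, of dimension $n$, let $\mu$ be a volume form on $M$ (a smooth nowhere vanishing $n$-form), and let $M$ carry the orientation for which $\mu$ is positive. Let $m_\mu$ be the unique Borel measure on $M$ with $\int_M F\,\mathrm{d}m_\mu=\int_M F\mu$ for all continuous compactly supported $F:M\to\mathbb{R}$. Let $b$ be a geometric structure on $M$, that is, a smooth non-degenerate $(0,2)$-tensor field (no symmetry is assumed). For $F\in C^\infty(M,\mathbb{R})$ let the vector fields $\nabla^L_bF$ and $\nabla^R_bF$ be defined by $$b(\nabla^L_bF,X)=\mathrm{d}F\cdot X,\qquad b(X,\nabla^R_bF)=\mathrm{d}F\cdot X\qquad\text{for all vector fields }X,$$ and put $\{F,G\}_b:=b(\nabla^L_bF,\nabla^L_bG)=b(\nabla^R_bF,\nabla^R_bG)$, $\Delta^L_bF:=\operatorname{div}_\mu(\nabla^L_bF)$ and $\Delta^R_bF:=\operatorname{div}_\mu(\nabla^R_bF)$, where $\operatorname{div}_\mu X$ is the function with $\mathcal{L}_X\mu=(\operatorname{div}_\mu X)\,\mu$. Then for all smooth compactly supported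 $F,G:M\to\mathbb{R}$ all the integrals below converge, the functions $F$, $G$, $\Delta^L_bG$, $\Delta^R_bF$ lie in $L^2(M,m_\mu)$, and 1. $\displaystyle\int_M F\,\Delta^L_bG\,\mathrm{d}m_\mu=-\int_M\{F,G\}_b\,\mathrm{d}m_\mu$; 2. $\displaystyle\int_M F\,\Delta^R_bG\,\mathrm{d}m_\mu=-\int_M\{G,F\}_b\,\mathrm{d}m_\mu$; 3. $\displaystyle(\Delta^L_bG,F)=\int_M F\,\Delta^L_bG\,\mathrm{d}m_\mu=\int_M G\,\Delta^R_bF\,\mathrm{d}m_\mu=(G,\Delta^R_bF)$, where $(\cdot,\cdot)$ is the inner product of $L^2(M,m_\mu)$. -/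

import Mathlib

open scoped Manifold ContDiff Topology CompactlySupported
open MeasureTheory Set

noncomputable section

namespace GeometricManifold

/-- The model space `ℝⁿ`. -/
abbrev Model (n : ℕ) : Type := EuclideanSpace ℝ (Fin n)

/-- The standard basis of `ℝⁿ`. -/
def stdFrame (n : ℕ) : Fin n → Model n := fun i => EuclideanSpace.basisFun (Fin n) ℝ i

section Fields

variable (n : ℕ) (M : Type*) [TopologicalSpace M] [ChartedSpace (Model n) M]

/-- (Not necessarily smooth) vector fields on `M`. -/
abbrev VField : Type _ := Π x : M, TangentSpace (𝓡 n) x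

/-- (Not necessarily smooth) differential forms of degree `k` on `M`. -/
abbrev DForm (k : ℕ) : Type _ := Π x : M, (TangentSpace (𝓡 n) x) [⋀^Fin k]→L[ℝ] ℝ

end Fields

section Local

variable {n : ℕ} {M : Type*} [TopologicalSpace M] [ChartedSpace (Model n) M] {k : ℕ}

/-- The expression of a differential form in the preferred chart around `p`: its pullback to `ℝⁿ`
by the inverse of the chart. -/
def formInChart (η : DForm n M k) (p : M) : Model n → (Model n) [⋀^Fin k]→L[ℝ] ℝ :=
  fun y => ((η ((extChartAt (𝓡 n) p).symm y)).compContinuousLinearMap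
    (mfderiv 𝓘(ℝ, Model n) (𝓡 n) (extChartAt (𝓡 n) p).symm y) :
    (TangentSpace 𝓘(ℝ, Model n) y) [⋀^Fin k]→L[ℝ] ℝ)

lemma formInChart_apply (η : DForm n M k) (p : M) (y : Model n) (v : Fin k → Model n) :
    formInChart η p y v = η ((extChartAt (𝓡 n) p).symm y)
      (fun i => mfderiv 𝓘(ℝ, Model n) (𝓡 n) (extChartAt (𝓡 n) p).symm y (v i)) := rfl

/-- The expression of a vector field in the preferred chart around `p`. -/
def fieldInChart (X : VField n M) (p : M) : Model n → Model n :=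
  VectorField.mpullback 𝓘(ℝ, Model n) (𝓡 n) (extChartAt (𝓡 n) p).symm X

/-- Lie derivative of a differential form on `ℝⁿ` along a vector field, by Cartan's formula
`L_X η = d (i_X η) + i_X (d η)` (where `i_X` vanishes on `0`-forms). -/
def lieDerivLocal : {k : ℕ} → (Model n → Model n) → (Model n → (Model n) [⋀^Fin k]→L[ℝ] ℝ) →
    Model n → (Model n) [⋀^Fin k]→L[ℝ] ℝ
  | 0, X, η => fun y => (extDeriv η y).curryLeft (X y)
  | _ + 1, X, η => fun y =>
      extDeriv (fun z => (η z).curryLeft (X z)) y + (extDeriv η y).curryLeft (X y)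

/-- Lie derivative of a differential form along a vector field on a manifold: computed in
the preferred chart around the point, and transported back to the tangent space. -/
def lieDeriv (X : VField n M) (η : DForm n M k) : DForm n M k := fun p =>
  (lieDerivLocal (fieldInChart X p) (formInChart η p) (extChartAt (𝓡 n) p p) :
    (TangentSpace 𝓘(ℝ, Model n) (extChartAt (𝓡 n) p p)) [⋀^Fin k]→L[ℝ] ℝ).compContinuousLinearMap
    (mfderiv (𝓡 n) 𝓘(ℝ, Model n) (extChartAt (𝓡 n) p) p)

lemma lieDeriv_apply (X : VField n M) (η : DForm n M k) (p : M)
    (v : Fin k → TangentSpace (𝓡 n) p) :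
    lieDeriv X η p v = lieDerivLocal (fieldInChart X p) (formInChart η p) (extChartAt (𝓡 n) p p)
      (fun i => mfderiv (𝓡 n) 𝓘(ℝ, Model n) (extChartAt (𝓡 n) p) p (v i)) := rfl

variable (n M) in
/-- A volume form: a smooth, nowhere vanishing differential form of top degree. -/
structure VolumeForm where
  /-- the underlying form -/
  form : DForm n M n
  smooth : ∀ p : M, ContDiffOn ℝ ∞ (formInChart form p) (extChartAt (𝓡 n) p).target
  ne_zero : ∀ p : M, form p ≠ 0

variable (n M) in
/-- A geometric structure: a smooth non-degenerate `(0,2)`-tensor field. -/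
structure GeometricStructure [IsManifold (𝓡 n) ∞ M] where
  /-- the underlying family of bilinear forms -/
  form : Π x : M, TangentSpace (𝓡 n) x →L[ℝ] TangentSpace (𝓡 n) x →L[ℝ] ℝ
  smooth : ContMDiff (𝓡 n) ((𝓡 n).prod 𝓘(ℝ, Model n →L[ℝ] Model n →L[ℝ] ℝ)) ∞
    (fun x => Bundle.TotalSpace.mk' (Model n →L[ℝ] Model n →L[ℝ] ℝ)
      (E := fun x => TangentSpace (𝓡 n) x →L[ℝ] TangentSpace (𝓡 n) x →L[ℝ] ℝ) x (form x))
  nondegenerate_left : ∀ (x : M) (v : TangentSpace (𝓡 n) x), (∀ w, form x v w = 0) → v = 0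
  nondegenerate_right : ∀ (x : M) (w : TangentSpace (𝓡 n) x), (∀ v, form x v w = 0) → w = 0

/-- The differential of a function at a point, as a linear form on the tangent space. -/
def differential (F : M → ℝ) (x : M) : TangentSpace (𝓡 n) x →L[ℝ] ℝ :=
  mfderiv (𝓡 n) 𝓘(ℝ, ℝ) F x

end Local

section LinearAlgebra

/-- Riesz-type representation for a bilinear form without left kernel. -/
lemma existsUnique_represent {V : Type*} [AddCommGroup V] [Module ℝ V] [FiniteDimensional ℝ V]
    (B : V →ₗ[ℝ] V →ₗ[ℝ] ℝ) (hB : ∀ v, (∀ w, B v w = 0) → v = 0) (l : V →ₗ[ℝ] ℝ) :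
    ∃! v, ∀ w, B v w = l w := by
  have hinj : Function.Injective B := by
    rw [← LinearMap.ker_eq_bot, LinearMap.ker_eq_bot']
    intro v hv
    exact hB v fun w => by rw [hv]; rfl
  have hsurj : Function.Surjective B :=
    (LinearMap.injective_iff_surjective_of_finrank_eq_finrank
      (Subspace.dual_finrank_eq (K := ℝ) (V := V)).symm).1 hinj
  obtain ⟨v, hv⟩ := hsurj l
  refine ⟨v, fun w => by rw [hv], fun u hu => hinj ?_⟩
  rw [hv]
  exact LinearMap.ext hu

/-- Top degree forms on an `n`-dimensional space are proportional to any non-zero one. -/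
lemma existsUnique_smul {V : Type*} [AddCommGroup V] [Module ℝ V] [TopologicalSpace V] {n : ℕ}
    (e : Module.Basis (Fin n) ℝ V) (μ θ : V [⋀^Fin n]→L[ℝ] ℝ) (hμ : μ ≠ 0) :
    ∃! c : ℝ, θ = c • μ := by
  have h (η : V [⋀^Fin n]→L[ℝ] ℝ) (v : Fin n → V) : η v = η e * e.det v := by
    have := AlternatingMap.eq_smul_basis_det e η.toAlternatingMap
    have := congrArg (fun f => f v) this
    simpa using this
  have hne : μ e ≠ 0 := by
    intro h0
    apply hμ
    ext v
    rw [h, h0]; simp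
  refine ⟨θ e / μ e, ?_, ?_⟩
  · ext v
    rw [h θ v, ContinuousAlternatingMap.smul_apply, h μ v, smul_eq_mul, ← mul_assoc,
      div_mul_cancel₀ _ hne]
  · rintro c rfl
    simp [hne]

end LinearAlgebra

section Operators

variable {n : ℕ} {M : Type*} [TopologicalSpace M] [ChartedSpace (Model n) M]

lemma existsUnique_divergence (μ : VolumeForm n M) (X : VField n M) (x : M) :
    ∃! c : ℝ, lieDeriv X μ.form x = c • μ.form x :=
  existsUnique_smul (V := TangentSpace (𝓡 n) x) (EuclideanSpace.basisFun (Fin n) ℝ).toBasis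
    (μ.form x) _ (μ.ne_zero x)

/-- The divergence of a vector field with respect to a volume form: the unique function with
`L_X μ = (div_μ X) μ`. -/
def divergence (μ : VolumeForm n M) (X : VField n M) (x : M) : ℝ :=
  (existsUnique_divergence μ X x).choose

lemma lieDeriv_eq_divergence_smul (μ : VolumeForm n M) (X : VField n M) (x : M) :
    lieDeriv X μ.form x = divergence μ X x • μ.form x :=
  (existsUnique_divergence μ X x).choose_spec.1

variable [IsManifold (𝓡 n) ∞ M]

lemma existsUnique_leftGradient (b : GeometricStructure n M) (F : M → ℝ) (x : M) :
    ∃! v : TangentSpace (𝓡 n) x, ∀ w, b.form x v w = differential F x w :=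
  haveI : FiniteDimensional ℝ (TangentSpace (𝓡 n) x) :=
    inferInstanceAs (FiniteDimensional ℝ (Model n))
  existsUnique_represent (V := TangentSpace (𝓡 n) x)
    ((ContinuousLinearMap.coeLM ℝ).comp (b.form x).toLinearMap)
    (b.nondegenerate_left x) (differential F x).toLinearMap

lemma existsUnique_rightGradient (b : GeometricStructure n M) (F : M → ℝ) (x : M) :
    ∃! v : TangentSpace (𝓡 n) x, ∀ w, b.form x w v = differential F x w :=
  haveI : FiniteDimensional ℝ (TangentSpace (𝓡 n) x) :=
    inferInstanceAs (FiniteDimensional ℝ (Model n))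
  existsUnique_represent (V := TangentSpace (𝓡 n) x)
    ((ContinuousLinearMap.coeLM ℝ).comp (b.form x).toLinearMap).flip
    (b.nondegenerate_right x) (differential F x).toLinearMap

/-- The left-gradient: `b (∇ᴸ F, X) = dF · X` for all `X`. -/
def leftGradient (b : GeometricStructure n M) (F : M → ℝ) : VField n M := fun x =>
  (existsUnique_leftGradient b F x).choose

/-- The right-gradient: `b (X, ∇ᴿ F) = dF · X` for all `X`. -/
def rightGradient (b : GeometricStructure n M) (F : M → ℝ) : VField n M := fun x =>
  (existsUnique_rightGradient b F x).choose

lemma leftGradient_spec (b : GeometricStructure n M) (F : M → ℝ) (x : M)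
    (w : TangentSpace (𝓡 n) x) : b.form x (leftGradient b F x) w = differential F x w :=
  (existsUnique_leftGradient b F x).choose_spec.1 w

lemma rightGradient_spec (b : GeometricStructure n M) (F : M → ℝ) (x : M)
    (w : TangentSpace (𝓡 n) x) : b.form x w (rightGradient b F x) = differential F x w :=
  (existsUnique_rightGradient b F x).choose_spec.1 w

/-- The bracket `{F, G}_b = b (∇ᴸ F, ∇ᴸ G)`. -/
def bracket (b : GeometricStructure n M) (F G : M → ℝ) (x : M) : ℝ :=
  b.form x (leftGradient b F x) (leftGradient b G x)

/-- The two expressions of the bracket agree. -/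
lemma bracket_eq_right (b : GeometricStructure n M) (F G : M → ℝ) (x : M) :
    bracket b F G x = b.form x (rightGradient b F x) (rightGradient b G x) := by
  rw [bracket, leftGradient_spec, ← rightGradient_spec b F x (leftGradient b G x),
    leftGradient_spec, rightGradient_spec]

/-- The left-Laplacian `Δᴸ F = div_μ (∇ᴸ F)`. -/
def leftLaplacian (b : GeometricStructure n M) (μ : VolumeForm n M) (F : M → ℝ) : M → ℝ :=
  divergence μ (leftGradient b F)

/-- The right-Laplacian `Δᴿ F = div_μ (∇ᴿ F)`. -/
def rightLaplacian (b : GeometricStructure n M) (μ : VolumeForm n M) (F : M → ℝ) : M → ℝ :=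
  divergence μ (rightGradient b F)

end Operators

section Integration

variable {n : ℕ} {M : Type*} [TopologicalSpace M] [ChartedSpace (Model n) M]

lemma exists_chartPartition (n : ℕ) (M : Type*) [TopologicalSpace M] [ChartedSpace (Model n) M]
    [T2Space M] [ParacompactSpace M] :
    ∃ ρ : PartitionOfUnity M M univ, ρ.IsSubordinate fun p => (extChartAt (𝓡 n) p).source :=
  PartitionOfUnity.exists_isSubordinate isClosed_univ _ (fun p => isOpen_extChartAt_source p)
    fun p _ => mem_iUnion.2 ⟨p, mem_extChartAt_source p⟩

/-- A partition of unity subordinate to the cover of `M` by the preferred charts. -/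
def chartPartition (n : ℕ) (M : Type*) [TopologicalSpace M] [ChartedSpace (Model n) M]
    [T2Space M] [ParacompactSpace M] : PartitionOfUnity M M univ :=
  (exists_chartPartition n M).choose

lemma chartPartition_isSubordinate (n : ℕ) (M : Type*) [TopologicalSpace M]
    [ChartedSpace (Model n) M] [T2Space M] [ParacompactSpace M] :
    (chartPartition n M).IsSubordinate fun p => (extChartAt (𝓡 n) p).source :=
  (exists_chartPartition n M).choose_spec

/-- The sign at `y` of the coordinate frame of the chart around `p`: `1` if the frame is positively
oriented for the orientation of `M` defined by the volume form `μ`, and `-1` if it is negatively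
oriented. -/
def chartSign (μ : VolumeForm n M) (p : M) (y : Model n) : ℝ :=
  (SignType.sign (formInChart μ.form p y (stdFrame n)) : ℝ)

/-- The integral over the coordinate domain of the chart around `p` of a form of top degree `η`,
where `M` carries the orientation defined by the volume form `μ`. -/
def chartIntegral (μ : VolumeForm n M) (p : M) (η : DForm n M n) : ℝ :=
  ∫ y in (extChartAt (𝓡 n) p).target, chartSign μ p y * formInChart η p y (stdFrame n)

variable [T2Space M] [ParacompactSpace M]

/-- The integral of a (compactly supported) form of top degree `η` over the manifold `M` oriented
by the volume form `μ`: the sum of the integrals of the forms `ρ_p η` over the charts,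
where `ρ` is a partition of unity subordinate to the charts. -/
def formIntegral (μ : VolumeForm n M) (η : DForm n M n) : ℝ :=
  ∑ᶠ p : M, chartIntegral μ p fun x => chartPartition n M p x • η x

/-- The integrand of `F μ` in the chart around `p` is `|μ(∂₁, …, ∂ₙ)|` times the function. -/
lemma chartIntegral_eq (μ : VolumeForm n M) (p : M) (F : M → ℝ) :
    chartIntegral μ p (fun x => chartPartition n M p x • F x • μ.form x) =
      ∫ y in (extChartAt (𝓡 n) p).target,
        ((chartPartition n M p : M → ℝ) * (F : M → ℝ)) ((extChartAt (𝓡 n) p).symm y) *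
          |formInChart μ.form p y (stdFrame n)| := by
  refine integral_congr_ae (Filter.Eventually.of_forall fun y => ?_)
  change chartSign μ p y * (chartPartition n M p ((extChartAt (𝓡 n) p).symm y) •
    F ((extChartAt (𝓡 n) p).symm y) • formInChart μ.form p y (stdFrame n)) = _
  simp only [chartSign, smul_eq_mul, Pi.mul_apply]
  rcases lt_trichotomy (formInChart μ.form p y (stdFrame n)) 0 with h | h | h <;>
    simp [h, abs_of_neg, abs_of_pos, mul_assoc]

lemma integrableOn_chart (μ : VolumeForm n M) (p : M) (F : C_c(M, ℝ)) :
    IntegrableOn (fun y => ((chartPartition n M p : M → ℝ) * (F : M → ℝ)) ((extChartAt (𝓡 n) p).symm y) *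
      |formInChart μ.form p y (stdFrame n)|) (extChartAt (𝓡 n) p).target := by
  set e := extChartAt (𝓡 n) p
  set K : Set M := tsupport (chartPartition n M p) ∩ tsupport F
  have hKs : K ⊆ e.source := inter_subset_left.trans (chartPartition_isSubordinate n M p)
  have hK : IsCompact K := F.hasCompactSupport.isCompact.inter_left (isClosed_tsupport _)
  have hK' : IsCompact (e '' K) :=
    hK.image_of_continuousOn ((continuousOn_extChartAt p).mono hKs)
  have hsub : e '' K ⊆ e.target := by
    rintro _ ⟨x, hx, rfl⟩
    exact e.map_source (hKs hx)
  have hc : ContinuousOn (fun y => ((chartPartition n M p : M → ℝ) * (F : M → ℝ)) (e.symm y) *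
      |formInChart μ.form p y (stdFrame n)|) e.target := by
    refine ContinuousOn.mul ?_ (ContinuousOn.abs ?_)
    · exact ((chartPartition n M p).continuous.mul F.continuous).comp_continuousOn
        (continuousOn_extChartAt_symm p)
    · have := (μ.smooth p).continuousOn
      exact (ContinuousAlternatingMap.apply ℝ (Model n) ℝ (stdFrame n)).continuous.comp_continuousOn
        this
  refine ((hc.mono hsub).integrableOn_compact hK').of_forall_sdiff_eq_zero
    (isOpen_extChartAt_target p).measurableSet fun y hy => ?_
  have : ((chartPartition n M p : M → ℝ) * (F : M → ℝ)) (e.symm y) = 0 := by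
    by_contra h
    refine hy.2 ⟨e.symm y, ⟨subset_tsupport _ ?_, subset_tsupport _ ?_⟩, e.right_inv hy.1⟩
    · exact left_ne_zero_of_mul h
    · exact right_ne_zero_of_mul h
  rw [this, zero_mul]

lemma finite_support_chartIntegral (μ : VolumeForm n M) (F : C_c(M, ℝ)) :
    (Function.support fun p =>
      chartIntegral μ p fun x => chartPartition n M p x • F x • μ.form x).Finite := by
  refine ((chartPartition n M).locallyFinite.finite_nonempty_inter_compact
    F.hasCompactSupport.isCompact).subset fun p hp => ?_
  by_contra h
  refine hp ?_
  have h0 : ((chartPartition n M p : M → ℝ) * (F : M → ℝ) : M → ℝ) = 0 := by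
    funext x
    by_contra hx
    exact h ⟨x, left_ne_zero_of_mul hx, subset_tsupport _ (right_ne_zero_of_mul hx)⟩
  change chartIntegral μ p _ = 0
  rw [chartIntegral_eq, h0]
  simp

/-- The functional `F ↦ ∫_M F μ` on continuous compactly supported functions. -/
def volumeFunctional (μ : VolumeForm n M) : C_c(M, ℝ) →ₚ[ℝ] ℝ :=
  PositiveLinearMap.mk₀
    { toFun := fun F => formIntegral μ fun x => F x • μ.form x
      map_add' := fun F G => by
        rw [formIntegral, formIntegral, formIntegral, ← finsum_add_distrib
          (finite_support_chartIntegral μ F) (finite_support_chartIntegral μ G)]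
        refine finsum_congr fun p => ?_
        rw [chartIntegral_eq, chartIntegral_eq, chartIntegral_eq,
          ← integral_add (integrableOn_chart μ p F) (integrableOn_chart μ p G)]
        congr 1
        funext y
        simp only [Pi.mul_apply, CompactlySupportedContinuousMap.coe_add, Pi.add_apply]
        ring
      map_smul' := fun c F => by
        rw [formIntegral, formIntegral, RingHom.id_apply, smul_finsum]
        refine finsum_congr fun p => ?_
        rw [chartIntegral_eq, chartIntegral_eq, ← integral_smul]
        congr 1
        funext y
        simp only [Pi.mul_apply, CompactlySupportedContinuousMap.coe_smul, Pi.smul_apply,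
          smul_eq_mul]
        ring }
    (fun F hF => finsum_nonneg fun p => by
      rw [chartIntegral_eq]
      refine integral_nonneg fun y => mul_nonneg (mul_nonneg ?_ (hF _)) (abs_nonneg _)
      exact (chartPartition n M).nonneg p _)

variable [MeasurableSpace M] [BorelSpace M]

/-- The measure `m_μ` attached to a volume form `μ` on the manifold `M` oriented by `μ`: the Borel
measure representing the functional `F ↦ ∫_M F μ` (Riesz representation theorem). -/
def volumeMeasure (μ : VolumeForm n M) : Measure M :=
  haveI : LocallyCompactSpace M := Manifold.locallyCompact_of_finiteDimensional (𝓡 n)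
  RealRMK.rieszMeasure (volumeFunctional μ)

lemma integral_volumeMeasure (μ : VolumeForm n M) (F : C_c(M, ℝ)) :
    ∫ x, F x ∂(volumeMeasure μ) = formIntegral μ fun x => F x • μ.form x :=
  haveI : LocallyCompactSpace M := Manifold.locallyCompact_of_finiteDimensional (𝓡 n)
  RealRMK.integral_rieszMeasure (volumeFunctional μ) F

end Integration

end GeometricManifold

end

/-! The theorem is integration by parts. For a smooth field `X` and a smooth compactly supported
`F`, the function `F div_μ X + dF · X` is the divergence of `F X`, and its integral vanishes
(`integral_divergenceSmul`). Taking `X = ∇ᴸ G` gives the first identity, because `dF · ∇ᴸ G = b (∇ᴸ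
F, ∇ᴸ G)`. Taking `X = ∇ᴿ G` gives the second, because `dF · ∇ᴿ G = b (∇ᴿ G, ∇ᴿ F)`, the bracket
with its arguments exchanged. The first identity for `(F, G)` and the second for `(G, F)` then have
the same right-hand side, so `Δᴸ` and `Δᴿ` are adjoint to each other without any symmetry of `b`.

The divergence theorem is proved in coordinates. If `ρ` is the density of `μ` in a chart, then
`(div_μ X) ρ = ∑ ∂ᵢ (ρ Xⁱ)` (`divergence_mul_chartDensity`). The Lie derivative is defined at each
point through the chart preferred at that point, so this formula on a whole chart needs naturality
under transition maps (`lieDerivLocal_pullback`). Since `|ρ|` changes by the absolute Jacobian, the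
integral of a function supported in one chart can be computed there
(`integral_volumeMeasure_eq_setIntegral`). It becomes an integral of partial derivatives of
compactly supported functions on `ℝⁿ`, hence zero. Finitely many bump functions reduce a general `F`
to this case.

The gradients are smooth because inversion of invertible linear maps is smooth
(`contDiffOn_of_represents`). The Laplacians are therefore continuous, and they are compactly
supported because divergence is local; this gives convergence and membership in `L²`. -/

noncomputable section

namespace GeometricManifold

/-! ### Transition maps; Lie derivative and divergence in coordinates -/

section ChartCalculus

variable {n : ℕ} {M : Type*} [TopologicalSpace M] [ChartedSpace (Model n) M]

/-- The transition map from the chart around `p` to the chart around `q`. -/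
def chartChange (p q : M) (y : Model n) : Model n :=
  extChartAt (𝓡 n) q ((extChartAt (𝓡 n) p).symm y)

/-- The domain of the transition map from the chart around `p` to the chart around `q`. -/
def chartOverlap (p q : M) : Set (Model n) :=
  (extChartAt (𝓡 n) p).target ∩ (extChartAt (𝓡 n) p).symm ⁻¹' (extChartAt (𝓡 n) q).source

lemma isOpen_chartOverlap (p q : M) : IsOpen (chartOverlap (n := n) p q) :=
  (continuousOn_extChartAt_symm p).isOpen_inter_preimage (isOpen_extChartAt_target p)
    (isOpen_extChartAt_source q)

lemma chartChange_mem_overlap {p q : M} {y : Model n} (hy : y ∈ chartOverlap p q) :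
    chartChange p q y ∈ chartOverlap q p := by
  refine ⟨(extChartAt (𝓡 n) q).map_source hy.2, ?_⟩
  simp only [chartChange, mem_preimage]
  rw [(extChartAt (𝓡 n) q).left_inv hy.2]
  exact (extChartAt (𝓡 n) p).map_target hy.1

lemma symm_chartChange {p q : M} {y : Model n} (hy : y ∈ chartOverlap p q) :
    (extChartAt (𝓡 n) q).symm (chartChange p q y) = (extChartAt (𝓡 n) p).symm y :=
  (extChartAt (𝓡 n) q).left_inv hy.2

lemma chartChange_chartChange {p q : M} {y : Model n} (hy : y ∈ chartOverlap p q) :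
    chartChange q p (chartChange p q y) = y := by
  rw [chartChange, symm_chartChange hy, (extChartAt (𝓡 n) p).right_inv hy.1]

/-- The coordinate frame of the chart around `p`, as a linear isomorphism from `ℝⁿ` to the tangent
space. -/
def chartFrame (p : M) (y : Model n) : Model n →L[ℝ] Model n :=
  mfderiv 𝓘(ℝ, Model n) (𝓡 n) (extChartAt (𝓡 n) p).symm y

/-- The value of a differential form at a point, as a form on the model space. -/
def formAt {k : ℕ} (η : DForm n M k) (x : M) : (Model n) [⋀^Fin k]→L[ℝ] ℝ := η x

/-- The value of a vector field at a point, as a vector of the model space. -/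
def fieldAt (X : VField n M) (x : M) : Model n := X x

lemma formInChart_eq {k : ℕ} (η : DForm n M k) (p : M) (y : Model n) :
    formInChart η p y = (formAt η ((extChartAt (𝓡 n) p).symm y)).compContinuousLinearMap
      (chartFrame p y) := rfl

lemma fieldInChart_eq (X : VField n M) (p : M) (y : Model n) :
    fieldInChart X p y = (chartFrame p y).inverse (fieldAt X ((extChartAt (𝓡 n) p).symm y)) := rfl

variable [IsManifold (𝓡 n) ∞ M]

lemma contDiffAt_chartChange {p q : M} {y : Model n} (hy : y ∈ chartOverlap p q) :
    ContDiffAt ℝ ∞ (chartChange p q) y := by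
  have h1 : ContMDiffAt 𝓘(ℝ, Model n) (𝓡 n) ∞ (extChartAt (𝓡 n) p).symm y :=
    (contMDiffOn_extChartAt_symm p).contMDiffAt ((isOpen_extChartAt_target p).mem_nhds hy.1)
  have h2 : ContMDiffAt (𝓡 n) 𝓘(ℝ, Model n) ∞ (extChartAt (𝓡 n) q)
      ((extChartAt (𝓡 n) p).symm y) :=
    contMDiffOn_extChartAt.contMDiffAt ((chartAt (Model n) q).open_source.mem_nhds
      (by simpa using hy.2))
  exact (h2.comp y h1).contDiffAt

lemma mdifferentiableAt_chart_symm {p : M} {y : Model n} (hy : y ∈ (extChartAt (𝓡 n) p).target) :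
    MDifferentiableAt 𝓘(ℝ, Model n) (𝓡 n) (extChartAt (𝓡 n) p).symm y :=
  ((contMDiffOn_extChartAt_symm (n := ∞) p).contMDiffAt
    ((isOpen_extChartAt_target p).mem_nhds hy)).mdifferentiableAt (by simp)

lemma isInvertible_chartFrame {p : M} {y : Model n} (hy : y ∈ (extChartAt (𝓡 n) p).target) :
    (chartFrame p y).IsInvertible := by
  have : IsManifold (𝓡 n) 1 M := IsManifold.of_le (n := ∞) (by simp)
  have := isInvertible_mfderivWithin_extChartAt_symm (I := 𝓡 n) hy
  rw [ModelWithCorners.range_eq_univ, mfderivWithin_univ] at this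
  exact this

/-- Chain rule for the inverse chart at `p`, factored near `y` through the chart at `q`. The
transformation rules for forms and fields both rest on it. -/
lemma chartFrame_comp {p q : M} {y : Model n} (hy : y ∈ chartOverlap p q) :
    chartFrame p y = (chartFrame q (chartChange p q y)).comp (fderiv ℝ (chartChange p q) y) := by
  have h : (extChartAt (𝓡 n) p).symm =ᶠ[𝓝 y] (extChartAt (𝓡 n) q).symm ∘ chartChange p q := by
    filter_upwards [(isOpen_chartOverlap p q).mem_nhds hy] with z hz
    exact (symm_chartChange hz).symm
  have h1 := h.mfderiv_eq (I := 𝓘(ℝ, Model n)) (I' := 𝓡 n)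
  have h2 := mfderiv_comp (I := 𝓘(ℝ, Model n)) (I' := 𝓘(ℝ, Model n)) (I'' := 𝓡 n) y
    (mdifferentiableAt_chart_symm (chartChange_mem_overlap hy).1)
    ((contDiffAt_chartChange hy).differentiableAt (by simp)).mdifferentiableAt
  rw [mfderiv_eq_fderiv] at h2
  exact h1.trans h2

lemma isInvertible_fderiv_chartChange {p q : M} {y : Model n} (hy : y ∈ chartOverlap p q) :
    (fderiv ℝ (chartChange p q) y).IsInvertible := by
  have key {p q : M} {y : Model n} (hy : y ∈ chartOverlap p q) :
      (fderiv ℝ (chartChange q p) (chartChange p q y)).comp (fderiv ℝ (chartChange p q) y) =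
        ContinuousLinearMap.id ℝ (Model n) := by
    have hd := (contDiffAt_chartChange hy).differentiableAt (by simp)
    have hd' := (contDiffAt_chartChange (chartChange_mem_overlap hy)).differentiableAt (by simp)
    rw [← fderiv_comp y hd' hd, ← fderiv_id (x := y)]
    refine Filter.EventuallyEq.fderiv_eq ?_
    filter_upwards [(isOpen_chartOverlap p q).mem_nhds hy] with z hz
    exact chartChange_chartChange hz
  have h2 := key (chartChange_mem_overlap hy)
  rw [chartChange_chartChange hy] at h2
  exact ContinuousLinearMap.IsInvertible.of_inverse h2 (key hy)

lemma formInChart_change {k : ℕ} (η : DForm n M k) {p q : M} {y : Model n}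
    (hy : y ∈ chartOverlap p q) : formInChart η p y =
      (formInChart η q (chartChange p q y)).compContinuousLinearMap
        (fderiv ℝ (chartChange p q) y) := by
  rw [formInChart_eq, formInChart_eq, chartFrame_comp hy, symm_chartChange hy]
  rfl

lemma fieldInChart_change (X : VField n M) {p q : M} {y : Model n} (hy : y ∈ chartOverlap p q) :
    fderiv ℝ (chartChange p q) y (fieldInChart X p y) = fieldInChart X q (chartChange p q y) := by
  have hq := isInvertible_chartFrame (chartChange_mem_overlap hy).1
  have hψ := isInvertible_fderiv_chartChange hy
  rw [fieldInChart_eq, fieldInChart_eq, chartFrame_comp hy, hq.inverse_comp_of_left,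
    symm_chartChange hy, ContinuousLinearMap.comp_apply, hψ.self_apply_inverse]

omit [IsManifold (𝓡 n) ∞ M] in
lemma differentiableAt_contraction {k : ℕ} {η : Model n → (Model n) [⋀^Fin (k + 1)]→L[ℝ] ℝ}
    {X : Model n → Model n} {y : Model n} (hη : DifferentiableAt ℝ η y)
    (hX : DifferentiableAt ℝ X y) : DifferentiableAt ℝ (fun z => (η z).curryLeft (X z)) y := by
  have h : DifferentiableAt ℝ (fun z => (η z).curryLeft) y :=
    DifferentiableAt.comp (g := fun α : (Model n) [⋀^Fin (k + 1)]→L[ℝ] ℝ => α.curryLeft) y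
      (LinearIsometry.toContinuousLinearMap
        (ContinuousAlternatingMap.curryLeftLI (𝕜 := ℝ) (E := Model n) (F := ℝ)
          (n := k))).differentiableAt hη
  exact h.clm_apply hX

/-- The Lie derivative on `ℝⁿ` is natural with respect to local diffeomorphisms. -/
lemma lieDerivLocal_pullback {k : ℕ} {X Y : Model n → Model n} {ψ : Model n → Model n}
    {η θ : Model n → (Model n) [⋀^Fin k]→L[ℝ] ℝ} {y : Model n} (hψ : ContDiffAt ℝ ∞ ψ y)
    (hη : DifferentiableAt ℝ η (ψ y)) (hX : DifferentiableAt ℝ X (ψ y))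
    (hθ : ∀ᶠ z in 𝓝 y, θ z = (η (ψ z)).compContinuousLinearMap (fderiv ℝ ψ z))
    (hY : ∀ᶠ z in 𝓝 y, fderiv ℝ ψ z (Y z) = X (ψ z)) :
    lieDerivLocal Y θ y = (lieDerivLocal X η (ψ y)).compContinuousLinearMap (fderiv ℝ ψ y) := by
  -- Commuting `d` with pullback needs a `C²` map, since it uses the symmetry of the second
  -- derivative of `ψ`.
  have hr : minSmoothness ℝ 2 ≤ (∞ : WithTop ℕ∞) := by
    simp only [minSmoothness_of_isRCLikeNormedField]; exact WithTop.coe_le_coe.2 le_top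
  have h1 : extDeriv θ y = (extDeriv η (ψ y)).compContinuousLinearMap (fderiv ℝ ψ y) := by
    rw [← extDeriv_pullback hη hψ hr]
    exact Filter.EventuallyEq.extDeriv_eq hθ
  -- Interior product commutes with pullback once the vector is pushed forward; with naturality of
  -- `d`, both terms of Cartan's formula follow.
  have h2 {m : ℕ} (α : (Model n) [⋀^Fin (m + 1)]→L[ℝ] ℝ) (A : Model n →L[ℝ] Model n)
      (v : Model n) : (α.compContinuousLinearMap A).curryLeft v =
        (α.curryLeft (A v)).compContinuousLinearMap A := by
    ext w
    simp only [ContinuousAlternatingMap.curryLeft_apply_apply,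
      ContinuousAlternatingMap.compContinuousLinearMap_apply]
    congr 1
    funext i
    refine Fin.cases ?_ (fun j => ?_) i <;> simp
  cases k with
  | zero =>
    simp only [lieDerivLocal]
    rw [h1, h2, hY.self_of_nhds]
  | succ k =>
    simp only [lieDerivLocal]
    rw [h1, h2, hY.self_of_nhds]
    have h3 : extDeriv (fun z => (θ z).curryLeft (Y z)) y =
        (extDeriv (fun z => (η z).curryLeft (X z)) (ψ y)).compContinuousLinearMap
          (fderiv ℝ ψ y) := by
      rw [← extDeriv_pullback _ hψ hr]
      · refine Filter.EventuallyEq.extDeriv_eq ?_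
        filter_upwards [hθ, hY] with z h h'
        rw [h, h2, h']
      · exact differentiableAt_contraction hη hX
    rw [h3]
    rfl

/-- For a top form `i_X dη` vanishes, and `d (i_X η)` on the standard frame is the classical
divergence of the field `η(e₁, …, eₙ) X`. -/
lemma lieDerivLocal_stdFrame {X : Model n → Model n} {η : Model n → (Model n) [⋀^Fin n]→L[ℝ] ℝ}
    {y : Model n} (hη : DifferentiableAt ℝ η y) (hX : DifferentiableAt ℝ X y) :
    lieDerivLocal X η y (stdFrame n) =
      ∑ i, fderiv ℝ (fun z => η z (stdFrame n) * X z i) y (stdFrame n i) := by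
  cases n with
  | zero =>
    have : X y = 0 := Subsingleton.elim _ _
    simp [lieDerivLocal, this]
  | succ m =>
    have hd : DifferentiableAt ℝ (fun z => (η z).curryLeft (X z)) y :=
      differentiableAt_contraction hη hX
    -- `extDeriv η y` takes one more vector than the dimension, so its arguments are linearly
    -- dependent.
    have hzero : (extDeriv η y).curryLeft (X y) (stdFrame (m + 1)) = 0 := by
      rw [ContinuousAlternatingMap.curryLeft_apply_apply]
      refine AlternatingMap.map_linearDependent (extDeriv η y).toAlternatingMap _ fun h => ?_
      have := h.fintype_card_le_finrank
      simp at this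
    -- Moving `v` from slot `i` of the frame to the front costs the sign `(-1) ^ i`, the sign
    -- occurring in `extDeriv_apply`. When `v` is expanded in the basis, every term except the
    -- `i`-th repeats a frame vector.
    have hterm (α : (Model (m + 1)) [⋀^Fin (m + 1)]→L[ℝ] ℝ) (v : Model (m + 1))
        (i : Fin (m + 1)) : (-1) ^ (i : ℕ) * α.curryLeft v (i.removeNth (stdFrame (m + 1))) =
          α (stdFrame (m + 1)) * v i := by
      have h1 := AlternatingMap.map_insertNth α.toAlternatingMap i v
        (i.removeNth (stdFrame (m + 1)))
      rw [Fin.insertNth_removeNth] at h1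
      have h2 : v = ∑ j, v j • stdFrame (m + 1) j := by
        have := (EuclideanSpace.basisFun (Fin (m + 1)) ℝ).sum_repr v
        simpa [stdFrame] using this.symm
      nth_rw 1 [h2] at h1
      rw [AlternatingMap.map_update_sum, Finset.sum_eq_single i] at h1
      · rw [AlternatingMap.map_update_smul, Function.update_eq_self, zsmul_eq_mul] at h1
        change v i * α (stdFrame (m + 1)) = _ * α (Matrix.vecCons v _) at h1
        rw [ContinuousAlternatingMap.curryLeft_apply_apply, mul_comm (α _), h1]
        push_cast
        rfl
      · intro j _ hj
        rw [AlternatingMap.map_update_smul, AlternatingMap.map_update_self _ _ hj.symm, smul_zero]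
      · simp
    simp only [lieDerivLocal, ContinuousAlternatingMap.add_apply]
    rw [hzero, add_zero, extDeriv_apply hd]
    refine Finset.sum_congr rfl fun i _ => ?_
    have hdi : DifferentiableAt ℝ
        (fun z => (η z).curryLeft (X z) (i.removeNth (stdFrame (m + 1)))) y :=
      hd.continuousAlternatingMap_apply_const _
    simp_rw [← hterm]
    rw [fderiv_const_mul hdi]
    simp

lemma formAt_lieDeriv (X : VField n M) {k : ℕ} (η : DForm n M k) (x : M) :
    formAt (lieDeriv X η) x =
      lieDerivLocal (fieldInChart X x) (formInChart η x) (extChartAt (𝓡 n) x x) := by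
  have : IsManifold (𝓡 n) 1 M := IsManifold.of_le (n := ∞) (by simp)
  ext v
  refine (lieDeriv_apply X η x v).trans ?_
  rw [mfderiv_extChartAt_self]
  rfl

/-- The tangent space at `x` is identified with `ℝⁿ` through the preferred chart at `x` itself, so
that chart has identity derivative at its own centre. -/
lemma chartFrame_self (x : M) :
    chartFrame x (extChartAt (𝓡 n) x x) = ContinuousLinearMap.id ℝ (Model n) := by
  have : IsManifold (𝓡 n) 1 M := IsManifold.of_le (n := ∞) (by simp)
  have h := mfderivWithin_range_extChartAt_symm (I := 𝓡 n) (x := x)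
  rw [ModelWithCorners.range_eq_univ, mfderivWithin_univ] at h
  exact h

/-- `lieDeriv` uses a different chart at every point. Naturality under the transition map from the
chart at `q` to the chart at the point shows that one fixed chart computes it throughout its domain,
which makes differentiation and integration in that chart possible. -/
lemma formInChart_lieDeriv (X : VField n M) {k : ℕ} (η : DForm n M k)
    (hη : ∀ p : M, ContDiffOn ℝ ∞ (formInChart η p) (extChartAt (𝓡 n) p).target)
    (hX : ∀ p : M, ContDiffOn ℝ ∞ (fieldInChart X p) (extChartAt (𝓡 n) p).target)
    {q : M} {y : Model n} (hy : y ∈ (extChartAt (𝓡 n) q).target) :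
    formInChart (lieDeriv X η) q y = lieDerivLocal (fieldInChart X q) (formInChart η q) y := by
  set x := (extChartAt (𝓡 n) q).symm y with hx
  have hxy : chartChange q x y = extChartAt (𝓡 n) x x := rfl
  have hov : y ∈ chartOverlap q x := ⟨hy, mem_extChartAt_source (I := 𝓡 n) x⟩
  have hev := (isOpen_chartOverlap (n := n) q x).mem_nhds hov
  have ht : (extChartAt (𝓡 n) x).target ∈ 𝓝 (chartChange q x y) :=
    (isOpen_extChartAt_target (I := 𝓡 n) x).mem_nhds (mem_extChartAt_target x)
  rw [lieDerivLocal_pullback (contDiffAt_chartChange hov)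
    (((hη x).contDiffAt ht).differentiableAt (by simp))
    (((hX x).contDiffAt ht).differentiableAt (by simp))
    (Filter.eventually_of_mem hev fun z hz => formInChart_change η hz)
    (Filter.eventually_of_mem hev fun z hz => fieldInChart_change X hz),
    formInChart_eq, chartFrame_comp hov, ← hx, formAt_lieDeriv, hxy, chartFrame_self]
  rfl

/-- The density of a volume form in the chart around `q`. -/
def chartDensity (μ : VolumeForm n M) (q : M) (y : Model n) : ℝ :=
  formInChart μ.form q y (stdFrame n)

omit [IsManifold (𝓡 n) ∞ M] in
lemma contDiffOn_chartDensity (μ : VolumeForm n M) (q : M) :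
    ContDiffOn ℝ ∞ (chartDensity μ q) (extChartAt (𝓡 n) q).target :=
  (ContinuousAlternatingMap.apply ℝ (Model n) ℝ (stdFrame n)).contDiff.comp_contDiffOn (μ.smooth q)

/-- The divergence in coordinates: `(div_μ X) ρ = ∑ i, ∂ᵢ (ρ Xⁱ)`. -/
lemma divergence_mul_chartDensity (μ : VolumeForm n M) (X : VField n M)
    (hX : ∀ p : M, ContDiffOn ℝ ∞ (fieldInChart X p) (extChartAt (𝓡 n) p).target)
    {q : M} {y : Model n} (hy : y ∈ (extChartAt (𝓡 n) q).target) :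
    divergence μ X ((extChartAt (𝓡 n) q).symm y) * chartDensity μ q y =
      ∑ i, fderiv ℝ (fun z => chartDensity μ q z * fieldInChart X q z i) y (stdFrame n i) := by
  have hn := (isOpen_extChartAt_target (I := 𝓡 n) q).mem_nhds hy
  have h := lieDerivLocal_stdFrame (((μ.smooth q).contDiffAt hn).differentiableAt (by simp))
    (((hX q).contDiffAt hn).differentiableAt (by simp))
  rw [← formInChart_lieDeriv X μ.form μ.smooth hX hy, formInChart_apply,
    lieDeriv_eq_divergence_smul] at h
  exact h

lemma chartDensity_ne_zero (μ : VolumeForm n M) {q : M} {y : Model n}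
    (hy : y ∈ (extChartAt (𝓡 n) q).target) : chartDensity μ q y ≠ 0 := by
  obtain ⟨A, hA⟩ := isInvertible_chartFrame hy
  have h := (AlternatingMap.map_basis_ne_zero_iff
    ((EuclideanSpace.basisFun (Fin n) ℝ).toBasis.map A.toLinearEquiv)
    (formAt μ.form ((extChartAt (𝓡 n) q).symm y)).toAlternatingMap).2 fun h0 =>
      μ.ne_zero ((extChartAt (𝓡 n) q).symm y)
        (ContinuousAlternatingMap.toAlternatingMap_injective h0)
  convert! h using 1
  rw [chartDensity, formInChart_eq, ← hA]
  change formAt μ.form _ _ = formAt μ.form _ _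
  congr 1

/-- A top form is a multiple of the determinant, so pulling it back multiplies it by the Jacobian.
Absolute values remove the dependence on the orientation of the charts. -/
lemma abs_chartDensity_change (μ : VolumeForm n M) {p q : M} {y : Model n}
    (hy : y ∈ chartOverlap p q) : |chartDensity μ p y| =
      |(fderiv ℝ (chartChange p q) y).det| * |chartDensity μ q (chartChange p q y)| := by
  rw [chartDensity, formInChart_change μ.form hy, ← abs_mul]
  set A := fderiv ℝ (chartChange p q) y
  have h := AlternatingMap.eq_smul_basis_det (EuclideanSpace.basisFun (Fin n) ℝ).toBasis
    (formInChart μ.form q (chartChange p q y)).toAlternatingMap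
  have h1 := congrArg (fun f => f (A ∘ stdFrame n)) h
  have h2 : (EuclideanSpace.basisFun (Fin n) ℝ).toBasis.det (A ∘ stdFrame n) = A.det := by
    have := (EuclideanSpace.basisFun (Fin n) ℝ).toBasis.det_comp A.toLinearMap (stdFrame n)
    have h3 : stdFrame n = (EuclideanSpace.basisFun (Fin n) ℝ).toBasis := by
      funext i; simp [stdFrame]
    rw [h3, Module.Basis.det_self, mul_one, ← h3] at this
    exact this
  congr 1
  refine h1.trans ?_
  rw [AlternatingMap.smul_apply, smul_eq_mul, h2, mul_comm]
  refine congrArg (A.det * formInChart μ.form q (chartChange p q y) ·) ?_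
  funext i
  simp [stdFrame]

end ChartCalculus

/-! ### Integration in charts and independence of the chart -/

section ChartIntegration

/-- A function which is `C^k` on an open set and vanishes there outside a compact subset is `C^k`
when extended by zero. -/
lemma contDiff_indicator_of_isCompact {E : Type*} [NormedAddCommGroup E] [NormedSpace ℝ E]
    {k : WithTop ℕ∞} {u : E → ℝ} {U K : Set E} (hU : IsOpen U) (hK : IsCompact K) (hKU : K ⊆ U)
    (hu : ContDiffOn ℝ k u U) (h0 : ∀ y ∈ U \ K, u y = 0) : ContDiff ℝ k (U.indicator u) := by
  rw [contDiff_iff_contDiffAt]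
  intro y
  by_cases hy : y ∈ U
  · refine (hu.contDiffAt (hU.mem_nhds hy)).congr_of_eventuallyEq ?_
    filter_upwards [hU.mem_nhds hy] with z hz
    exact indicator_of_mem hz u
  · refine (contDiffAt_const (c := (0 : ℝ))).congr_of_eventuallyEq ?_
    filter_upwards [hK.isClosed.isOpen_compl.mem_nhds fun h => hy (hKU h)] with z hz
    by_cases hzU : z ∈ U
    · rw [indicator_of_mem hzU, h0 z ⟨hzU, hz⟩]
    · exact indicator_of_notMem hzU u

lemma hasCompactSupport_indicator {E : Type*} [TopologicalSpace E] [R1Space E] {u : E → ℝ}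
    {U K : Set E}
    (hK : IsCompact K) (h0 : ∀ y ∈ U \ K, u y = 0) : HasCompactSupport (U.indicator u) := by
  refine HasCompactSupport.intro hK fun y hy => ?_
  by_cases hyU : y ∈ U
  · rw [indicator_of_mem hyU, h0 y ⟨hyU, hy⟩]
  · exact indicator_of_notMem hyU u

lemma integrable_fderiv_apply {n : ℕ} {u : Model n → ℝ} (hu : ContDiff ℝ 1 u)
    (hc : HasCompactSupport u) (v : Model n) : Integrable (fun y => fderiv ℝ u y v) :=
  ((hu.continuous_fderiv (by simp)).clm_apply continuous_const).integrable_of_hasCompactSupport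
    (hc.fderiv_apply (𝕜 := ℝ) v)

/-- The integral of a partial derivative of a compactly supported function vanishes. -/
lemma integral_fderiv_eq_zero {n : ℕ} {u : Model n → ℝ} (hu : ContDiff ℝ 1 u)
    (hc : HasCompactSupport u) (v : Model n) : ∫ y, fderiv ℝ u y v = 0 := by
  have h1 : Integrable u := hu.continuous.integrable_of_hasCompactSupport hc
  have h2 := integrable_fderiv_apply hu hc v
  -- Integration by parts against the constant function `1`, whose derivative is zero.
  have := integral_mul_fderiv_eq_neg_fderiv_mul_of_integrable (μ := volume)
    (f := fun _ : Model n => (1 : ℝ)) (g := u) (v := v) (by simp) (by simpa using h2)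
    (by simpa using h1) (fun _ _ => differentiableAt_const _)
    (fun y _ => (hu.differentiable (by simp)) y)
  simpa using this

variable {n : ℕ} {M : Type*} [TopologicalSpace M] [ChartedSpace (Model n) M]

lemma isCompact_image_chart {K : Set M} (hK : IsCompact K) {q : M}
    (hKq : K ⊆ (extChartAt (𝓡 n) q).source) : IsCompact (extChartAt (𝓡 n) q '' K) :=
  hK.image_of_continuousOn ((continuousOn_extChartAt q).mono hKq)

lemma image_chart_subset_target {K : Set M} {q : M} (hKq : K ⊆ (extChartAt (𝓡 n) q).source) :
    extChartAt (𝓡 n) q '' K ⊆ (extChartAt (𝓡 n) q).target := by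
  rintro _ ⟨x, hx, rfl⟩
  exact (extChartAt (𝓡 n) q).map_source (hKq hx)

lemma eq_zero_of_notMem_image_chart {g : M → ℝ} {q : M} {y : Model n}
    (hy : y ∈ (extChartAt (𝓡 n) q).target \ extChartAt (𝓡 n) q '' tsupport g) :
    g ((extChartAt (𝓡 n) q).symm y) = 0 := by
  by_contra h
  exact hy.2 ⟨_, subset_tsupport _ h, (extChartAt (𝓡 n) q).right_inv hy.1⟩

lemma integrableOn_target {g : M → ℝ} (hg : Continuous g) (hgc : HasCompactSupport g) {q : M}
    (hgq : tsupport g ⊆ (extChartAt (𝓡 n) q).source) {h : Model n → ℝ}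
    (hh : ContinuousOn h (extChartAt (𝓡 n) q).target) :
    IntegrableOn (fun y => g ((extChartAt (𝓡 n) q).symm y) * h y) (extChartAt (𝓡 n) q).target := by
  have hc : ContinuousOn (fun y => g ((extChartAt (𝓡 n) q).symm y) * h y)
      (extChartAt (𝓡 n) q).target :=
    (hg.comp_continuousOn (continuousOn_extChartAt_symm q)).mul hh
  refine ((hc.mono (image_chart_subset_target hgq)).integrableOn_compact
    (isCompact_image_chart hgc.isCompact hgq)).of_forall_sdiff_eq_zero
    (isOpen_extChartAt_target q).measurableSet fun y hy => ?_
  rw [eq_zero_of_notMem_image_chart hy, zero_mul]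

variable [IsManifold (𝓡 n) ∞ M]

omit [IsManifold (𝓡 n) ∞ M] in
lemma image_chartChange (p q : M) :
    chartChange p q '' chartOverlap p q = chartOverlap (n := n) q p := by
  refine Subset.antisymm ?_ fun z hz => ?_
  · rintro _ ⟨y, hy, rfl⟩
    exact chartChange_mem_overlap hy
  · exact ⟨chartChange q p z, chartChange_mem_overlap hz, chartChange_chartChange hz⟩

/-- The integral of a function against the density of a volume form does not depend on the
chart. -/
lemma setIntegral_chart_change (μ : VolumeForm n M) (g : M → ℝ) {p q : M}
    (hp : Function.support g ⊆ (extChartAt (𝓡 n) p).source)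
    (hq : Function.support g ⊆ (extChartAt (𝓡 n) q).source) :
    ∫ y in (extChartAt (𝓡 n) p).target, g ((extChartAt (𝓡 n) p).symm y) * |chartDensity μ p y| =
      ∫ y in (extChartAt (𝓡 n) q).target,
        g ((extChartAt (𝓡 n) q).symm y) * |chartDensity μ q y| := by
  -- Where `g` is nonzero both charts are defined, so each integral lives on the overlap, and the
  -- transition map carries one overlap onto the other.
  have hred {p q : M} (hq : Function.support g ⊆ (extChartAt (𝓡 n) q).source) :
      ∫ y in (extChartAt (𝓡 n) p).target, g ((extChartAt (𝓡 n) p).symm y) * |chartDensity μ p y| =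
        ∫ y in chartOverlap p q, g ((extChartAt (𝓡 n) p).symm y) * |chartDensity μ p y| := by
    refine setIntegral_eq_of_subset_of_forall_sdiff_eq_zero
      (isOpen_extChartAt_target p).measurableSet inter_subset_left fun y hy => ?_
    have : g ((extChartAt (𝓡 n) p).symm y) = 0 := by
      by_contra h
      exact hy.2 ⟨hy.1, hq h⟩
    rw [this, zero_mul]
  rw [hred hq, hred hp, ← image_chartChange p q,
    integral_image_eq_integral_abs_det_fderiv_smul volume (isOpen_chartOverlap p q).measurableSet
      (fun y hy => ((contDiffAt_chartChange hy).differentiableAt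
        (by simp)).hasFDerivAt.hasFDerivWithinAt)
      (fun y hy z hz h => by rw [← chartChange_chartChange hy, h, chartChange_chartChange hz])]
  refine setIntegral_congr_fun (isOpen_chartOverlap p q).measurableSet fun y hy => ?_
  simp only [smul_eq_mul]
  rw [abs_chartDensity_change μ hy, symm_chartChange hy]
  ring

variable [T2Space M] [ParacompactSpace M] [MeasurableSpace M] [BorelSpace M]

/-- The integral of a function supported in a coordinate domain, computed in this chart. -/
lemma integral_volumeMeasure_eq_setIntegral (μ : VolumeForm n M) {f : M → ℝ} (hf : Continuous f)
    (hfc : HasCompactSupport f) {q : M} (hq : tsupport f ⊆ (extChartAt (𝓡 n) q).source) :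
    ∫ x, f x ∂(volumeMeasure μ) = ∫ y in (extChartAt (𝓡 n) q).target,
      f ((extChartAt (𝓡 n) q).symm y) * |chartDensity μ q y| := by
  -- Only finitely many members of the partition meet the support of `f`. This turns the `finsum`
  -- into a genuine finite sum, which may be exchanged with the integral.
  have hfin := (chartPartition n M).locallyFinite.finite_nonempty_inter_compact hfc.isCompact
  set ρ := chartPartition n M with hρ
  -- Each piece `ρ p * f` is supported in both charts, so all pieces can be moved to the chart at
  -- `q` and summed there.
  have hchart (p : M) : chartIntegral μ p (fun x => ρ p x • f x • μ.form x) =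
      ∫ y in (extChartAt (𝓡 n) q).target,
        (ρ p ((extChartAt (𝓡 n) q).symm y) * f ((extChartAt (𝓡 n) q).symm y)) *
          |chartDensity μ q y| := by
    refine (chartIntegral_eq μ p f).trans
      (setIntegral_chart_change μ (fun x => ρ p x * f x) ?_ ?_)
    · intro x hx
      exact chartPartition_isSubordinate n M p (subset_tsupport _ (left_ne_zero_of_mul hx))
    · intro x hx
      exact hq (subset_tsupport _ (right_ne_zero_of_mul hx))
  have h := integral_volumeMeasure μ ⟨⟨f, hf⟩, hfc⟩
  refine h.trans ?_
  change ∑ᶠ p : M, chartIntegral μ p (fun x => ρ p x • f x • μ.form x) = _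
  simp_rw [hchart]
  rw [finsum_eq_sum_of_support_subset (s := hfin.toFinset), ← integral_finsetSum]
  · refine setIntegral_congr_fun (isOpen_extChartAt_target q).measurableSet fun y _ => ?_
    simp only [← Finset.sum_mul]
    congr 1
    set x := (extChartAt (𝓡 n) q).symm y
    by_cases hx : f x = 0
    · simp [hx]
    · have h1 := ρ.sum_eq_one (mem_univ x)
      rw [finsum_eq_sum_of_support_subset (s := hfin.toFinset)] at h1
      · rw [h1, one_mul]
      · intro p hp
        simp only [Finite.coe_toFinset, mem_ofPred_eq]
        exact ⟨x, hp, subset_tsupport _ hx⟩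
  · intro p _
    refine integrableOn_target (g := fun x => ρ p x * f x) ((ρ p).continuous.mul hf) hfc.mul_left
      ((closure_mono ?_).trans hq) ((contDiffOn_chartDensity μ q).continuousOn.abs)
    exact Function.support_mul_subset_right _ _
  · intro p hp
    simp only [Finite.coe_toFinset, mem_ofPred_eq]
    by_contra hne
    refine hp ?_
    have h0 (x : M) : ρ p x * f x = 0 := by
      by_contra hx
      exact hne ⟨x, left_ne_zero_of_mul hx, subset_tsupport _ (right_ne_zero_of_mul hx)⟩
    simp [h0]

instance (μ : VolumeForm n M) : IsFiniteMeasureOnCompacts (volumeMeasure μ) := by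
  have : LocallyCompactSpace M := Manifold.locallyCompact_of_finiteDimensional (𝓡 n)
  unfold volumeMeasure
  infer_instance

end ChartIntegration

/-! ### Smoothness of the geometric structure and of the gradients in charts -/

section Gradients

variable {n : ℕ} {M : Type*} [TopologicalSpace M] [ChartedSpace (Model n) M]
  [IsManifold (𝓡 n) ∞ M]

/-- The expression of a function in the chart around `q`. -/
def funInChart (F : M → ℝ) (q : M) (y : Model n) : ℝ := F ((extChartAt (𝓡 n) q).symm y)

lemma contDiffOn_funInChart {F : M → ℝ} (hF : ContMDiff (𝓡 n) 𝓘(ℝ, ℝ) ∞ F) (q : M) :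
    ContDiffOn ℝ ∞ (funInChart (n := n) F q) (extChartAt (𝓡 n) q).target :=
  (hF.comp_contMDiffOn (contMDiffOn_extChartAt_symm q)).contDiffOn

lemma fderiv_funInChart {F : M → ℝ} (hF : ContMDiff (𝓡 n) 𝓘(ℝ, ℝ) ∞ F) {q : M} {y : Model n}
    (hy : y ∈ (extChartAt (𝓡 n) q).target) (v : Model n) :
    fderiv ℝ (funInChart F q) y v =
      differential F ((extChartAt (𝓡 n) q).symm y) (chartFrame q y v) := by
  have h := mfderiv_comp (I := 𝓘(ℝ, Model n)) (I' := 𝓡 n) (I'' := 𝓘(ℝ, ℝ)) y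
    ((hF _).mdifferentiableAt (by simp)) (mdifferentiableAt_chart_symm hy)
  rw [mfderiv_eq_fderiv] at h
  exact congrArg (fun A : Model n →L[ℝ] ℝ => A v) h

lemma chartFrame_fieldInChart (X : VField n M) {q : M} {y : Model n}
    (hy : y ∈ (extChartAt (𝓡 n) q).target) :
    chartFrame q y (fieldInChart X q y) = fieldAt X ((extChartAt (𝓡 n) q).symm y) := by
  rw [fieldInChart_eq, (isInvertible_chartFrame hy).self_apply_inverse]

lemma differential_apply_field {F : M → ℝ} (hF : ContMDiff (𝓡 n) 𝓘(ℝ, ℝ) ∞ F) (X : VField n M)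
    {q : M} {y : Model n} (hy : y ∈ (extChartAt (𝓡 n) q).target) :
    differential F ((extChartAt (𝓡 n) q).symm y) (X ((extChartAt (𝓡 n) q).symm y)) =
      fderiv ℝ (funInChart F q) y (fieldInChart X q y) := by
  rw [fderiv_funInChart hF hy, chartFrame_fieldInChart X hy]
  rfl

/-- The value of a geometric structure at a point, as a bilinear form on the model space. -/
def tensorAt (b : GeometricStructure n M) (x : M) : Model n →L[ℝ] Model n →L[ℝ] ℝ := b.form x

/-- The expression of a geometric structure in the chart around `q`. -/
def tensorInChart (b : GeometricStructure n M) (q : M) (y : Model n) :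
    Model n →L[ℝ] Model n →L[ℝ] ℝ :=
  (tensorAt b ((extChartAt (𝓡 n) q).symm y)).bilinearComp (chartFrame q y) (chartFrame q y)

lemma tensorInChart_apply (b : GeometricStructure n M) (q : M) (y v w : Model n) :
    tensorInChart b q y v w =
      tensorAt b ((extChartAt (𝓡 n) q).symm y) (chartFrame q y v) (chartFrame q y w) := rfl

/-- The coordinate fields are the images of constant fields on `ℝⁿ` under the tangent map of the
inverse chart. -/
lemma contMDiffOn_chartFrame (q : M) (v : Model n) :
    ContMDiffOn 𝓘(ℝ, Model n) (𝓡 n).tangent ∞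
      (fun y => Bundle.TotalSpace.mk' (Model n) (E := (TangentSpace (𝓡 n) : M → Type _))
        ((extChartAt (𝓡 n) q).symm y)
        (mfderiv 𝓘(ℝ, Model n) (𝓡 n) (extChartAt (𝓡 n) q).symm y v))
      (extChartAt (𝓡 n) q).target := by
  have h := (contMDiffOn_extChartAt_symm (I := 𝓡 n) (n := ∞) q).contMDiffOn_tangentMapWithin
    (m := ∞) (by simp) (isOpen_extChartAt_target q).uniqueMDiffOn
  have h2 : ContMDiffOn 𝓘(ℝ, Model n) 𝓘(ℝ, Model n).tangent ∞
      (fun y => Bundle.TotalSpace.mk' (Model n)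
        (E := (TangentSpace 𝓘(ℝ, Model n) : Model n → Type _)) y v)
      (extChartAt (𝓡 n) q).target :=
    contMDiffOn_vectorSpace_iff_contDiffOn.2 contDiffOn_const
  refine (h.comp h2 fun y hy => hy).congr fun y hy => ?_
  simp only [Function.comp_apply, tangentMapWithin]
  rw [mfderivWithin_of_isOpen (isOpen_extChartAt_target q) hy]

/-- In finite dimension a family of bilinear forms is smooth as soon as its values on fixed vectors
are; here these are values of `b` on two smooth coordinate fields. -/
lemma contDiffOn_tensorInChart (b : GeometricStructure n M) (q : M) :
    ContDiffOn ℝ ∞ (tensorInChart b q) (extChartAt (𝓡 n) q).target := by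
  refine contDiffOn_clm_apply.2 fun v => contDiffOn_clm_apply.2 fun w => ?_
  intro y hy
  have h : ContMDiffWithinAt 𝓘(ℝ, Model n) ((𝓡 n).prod 𝓘(ℝ, ℝ)) ∞
      (fun y => Bundle.TotalSpace.mk' ℝ (E := Bundle.Trivial M ℝ) ((extChartAt (𝓡 n) q).symm y)
        (b.form ((extChartAt (𝓡 n) q).symm y)
          (mfderiv 𝓘(ℝ, Model n) (𝓡 n) (extChartAt (𝓡 n) q).symm y v)
          (mfderiv 𝓘(ℝ, Model n) (𝓡 n) (extChartAt (𝓡 n) q).symm y w)))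
      (extChartAt (𝓡 n) q).target y := by
    apply ContMDiffWithinAt.clm_bundle_apply₂ (F₁ := Model n) (F₂ := Model n)
    · exact b.smooth.contMDiffAt.comp_contMDiffWithinAt y (contMDiffOn_extChartAt_symm q y hy)
    · exact contMDiffOn_chartFrame q v y hy
    · exact contMDiffOn_chartFrame q w y hy
  rw [Bundle.contMDiffWithinAt_totalSpace] at h
  exact h.2.contDiffWithinAt

lemma exists_chartFrame_eq {q : M} {y : Model n} (hy : y ∈ (extChartAt (𝓡 n) q).target)
    (w : Model n) : ∃ v, chartFrame q y v = w :=
  (isInvertible_chartFrame hy).surjective w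

lemma isInvertible_of_left_nondegenerate (B : Model n →L[ℝ] Model n →L[ℝ] ℝ)
    (hB : ∀ v, (∀ w, B v w = 0) → v = 0) : B.IsInvertible := by
  have hinj : Function.Injective B := (injective_iff_map_eq_zero B).2 fun v hv =>
    hB v fun w => by rw [hv]; rfl
  have hrank : Module.finrank ℝ (Model n) = Module.finrank ℝ (Model n →L[ℝ] ℝ) := by
    rw [← LinearMap.toContinuousLinearMap.finrank_eq]
    exact (Subspace.dual_finrank_eq (K := ℝ) (V := Model n)).symm
  exact ⟨(LinearEquiv.ofInjectiveOfFinrankEq B.toLinearMap hinj hrank).toContinuousLinearEquiv,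
    by ext; rfl⟩

/-- Solving a smooth non-degenerate family of linear equations gives a smooth vector field. -/
lemma contDiffOn_of_represents {U : Set (Model n)} {B : Model n → Model n →L[ℝ] Model n →L[ℝ] ℝ} (hB : ContDiffOn ℝ ∞ B U)
    (hnd : ∀ y ∈ U, ∀ v, (∀ w, B y v w = 0) → v = 0) {l : Model n → Model n →L[ℝ] ℝ}
    (hl : ContDiffOn ℝ ∞ l U) {X : Model n → Model n} (hX : ∀ y ∈ U, ∀ w, B y (X y) w = l y w) :
    ContDiffOn ℝ ∞ X U := by
  have h : ContDiffOn ℝ ∞ (fun y => (B y).inverse (l y)) U := by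
    refine ContDiffOn.clm_apply (fun y hy => ?_) hl
    have hi := isInvertible_of_left_nondegenerate (B y) (hnd y hy)
    -- Non-degeneracy makes `B y` an isomorphism onto the dual, and inversion is smooth at
    -- isomorphisms.
    exact hi.contDiffAt_map_inverse.comp_contDiffWithinAt y (hB y hy)
  refine h.congr fun y hy => ?_
  have hi := isInvertible_of_left_nondegenerate (B y) (hnd y hy)
  rw [← show B y (X y) = l y from ContinuousLinearMap.ext (hX y hy), hi.inverse_apply_self]

variable (b : GeometricStructure n M) {G : M → ℝ}

lemma contDiffOn_fderiv_funInChart (hG : ContMDiff (𝓡 n) 𝓘(ℝ, ℝ) ∞ G) (q : M) :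
    ContDiffOn ℝ ∞ (fderiv ℝ (funInChart (n := n) G q)) (extChartAt (𝓡 n) q).target :=
  (contDiffOn_funInChart hG q).fderiv_of_isOpen (isOpen_extChartAt_target q) (by simp)

lemma contDiffOn_leftGradient (hG : ContMDiff (𝓡 n) 𝓘(ℝ, ℝ) ∞ G) (q : M) :
    ContDiffOn ℝ ∞ (fieldInChart (leftGradient b G) q) (extChartAt (𝓡 n) q).target := by
  refine contDiffOn_of_represents (contDiffOn_tensorInChart b q)
    (fun y hy v hv => ?_) (contDiffOn_fderiv_funInChart hG q) fun y hy w => ?_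
  · refine (isInvertible_chartFrame hy).injective (Eq.trans ?_ (map_zero _).symm)
    refine b.nondegenerate_left ((extChartAt (𝓡 n) q).symm y) (chartFrame q y v) fun w => ?_
    obtain ⟨u, rfl⟩ := exists_chartFrame_eq hy w
    exact hv u
  · rw [tensorInChart_apply, chartFrame_fieldInChart _ hy, fderiv_funInChart hG hy]
    exact leftGradient_spec b G _ _

lemma contDiffOn_rightGradient (hG : ContMDiff (𝓡 n) 𝓘(ℝ, ℝ) ∞ G) (q : M) :
    ContDiffOn ℝ ∞ (fieldInChart (rightGradient b G) q) (extChartAt (𝓡 n) q).target := by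
  have hflip : ContDiffOn ℝ ∞ (fun y => (tensorInChart b q y).flip)
      (extChartAt (𝓡 n) q).target := by
    refine contDiffOn_clm_apply.2 fun v => contDiffOn_clm_apply.2 fun w => ?_
    have h := contDiffOn_clm_apply.1 (contDiffOn_clm_apply.1 (contDiffOn_tensorInChart b q) w) v
    exact h
  refine contDiffOn_of_represents hflip
    (fun y hy v hv => ?_) (contDiffOn_fderiv_funInChart hG q) fun y hy w => ?_
  · refine (isInvertible_chartFrame hy).injective (Eq.trans ?_ (map_zero _).symm)
    refine b.nondegenerate_right ((extChartAt (𝓡 n) q).symm y) (chartFrame q y v) fun w => ?_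
    obtain ⟨u, rfl⟩ := exists_chartFrame_eq hy w
    exact hv u
  · rw [ContinuousLinearMap.flip_apply, tensorInChart_apply, chartFrame_fieldInChart _ hy,
      fderiv_funInChart hG hy]
    exact rightGradient_spec b G _ _

end Gradients

/-! ### The divergence theorem for compactly supported functions -/

section DivergenceTheorem

variable {n : ℕ} {M : Type*} [TopologicalSpace M] [ChartedSpace (Model n) M]

lemma continuous_of_continuousOn_charts {f : M → ℝ} (h : ∀ q : M, ContinuousOn
    (fun y => f ((extChartAt (𝓡 n) q).symm y)) (extChartAt (𝓡 n) q).target) : Continuous f := by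
  refine continuous_iff_continuousAt.2 fun x => ?_
  have h1 := ((h x).continuousAt ((isOpen_extChartAt_target (I := 𝓡 n) x).mem_nhds
    (mem_extChartAt_target x))).comp (continuousAt_extChartAt (I := 𝓡 n) x)
  refine h1.congr ?_
  filter_upwards [(isOpen_extChartAt_source (I := 𝓡 n) x).mem_nhds (mem_extChartAt_source x)]
    with z hz
  simp only [Function.comp_apply]
  rw [(extChartAt (𝓡 n) x).left_inv hz]

lemma eq_sum_coord_smul_stdFrame (v : Model n) : v = ∑ i, v i • stdFrame n i := by
  have := (EuclideanSpace.basisFun (Fin n) ℝ).sum_repr v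
  simpa [stdFrame] using this.symm

variable [IsManifold (𝓡 n) ∞ M] {μ : VolumeForm n M} {X : VField n M} {F : M → ℝ}

omit [IsManifold (𝓡 n) ∞ M] in
lemma contDiffOn_density_mul_coord
    (hX : ∀ p : M, ContDiffOn ℝ ∞ (fieldInChart X p) (extChartAt (𝓡 n) p).target) (q : M)
    (i : Fin n) : ContDiffOn ℝ ∞ (fun z => chartDensity μ q z * fieldInChart X q z i)
      (extChartAt (𝓡 n) q).target :=
  (contDiffOn_chartDensity μ q).mul (contDiffOn_euclidean.1 (hX q) i)

lemma continuous_divergence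
    (hX : ∀ p : M, ContDiffOn ℝ ∞ (fieldInChart X p) (extChartAt (𝓡 n) p).target) :
    Continuous (divergence μ X) := by
  refine continuous_of_continuousOn_charts (n := n) fun q => ?_
  have h : ContinuousOn (fun y => (∑ i, fderiv ℝ (fun z => chartDensity μ q z *
      fieldInChart X q z i) y (stdFrame n i)) / chartDensity μ q y)
      (extChartAt (𝓡 n) q).target := by
    refine ContinuousOn.div (continuousOn_finsetSum _ fun i _ => ?_)
      (contDiffOn_chartDensity μ q).continuousOn fun y hy => chartDensity_ne_zero μ hy
    exact ((contDiffOn_density_mul_coord hX q i).continuousOn_fderiv_of_isOpen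
      (isOpen_extChartAt_target q) (by simp)).clm_apply continuousOn_const
  refine h.congr fun y hy => ?_
  beta_reduce
  rw [← divergence_mul_chartDensity μ X hX hy, mul_div_cancel_right₀ _ (chartDensity_ne_zero μ hy)]

lemma continuous_differential_apply (hF : ContMDiff (𝓡 n) 𝓘(ℝ, ℝ) ∞ F)
    (hX : ∀ p : M, ContDiffOn ℝ ∞ (fieldInChart X p) (extChartAt (𝓡 n) p).target) :
    Continuous (fun x => differential F x (X x)) := by
  refine continuous_of_continuousOn_charts (n := n) fun q => ?_
  refine ContinuousOn.congr (f := fun y => fderiv ℝ (funInChart F q) y (fieldInChart X q y)) ?_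
    fun y hy => differential_apply_field hF X hy
  exact (contDiffOn_fderiv_funInChart hF q).continuousOn.clm_apply (hX q).continuousOn

omit [IsManifold (𝓡 n) ∞ M] in
lemma differential_eq_zero_of_notMem_tsupport {x : M} (hx : x ∉ tsupport F) :
    differential (n := n) F x = 0 := by
  have h : F =ᶠ[𝓝 x] fun _ => (0 : ℝ) := notMem_tsupport_iff_eventuallyEq.1 hx
  have h1 := h.mfderiv_eq (I := 𝓡 n) (I' := 𝓘(ℝ, ℝ))
  rw [mfderiv_const] at h1
  exact h1

omit [IsManifold (𝓡 n) ∞ M] in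
lemma tsupport_differential_apply_subset :
    tsupport (fun x => differential F x (X x)) ⊆ tsupport F := by
  refine closure_minimal (fun x hx => ?_) (isClosed_tsupport F)
  by_contra h
  refine hx ?_
  simp only [differential_eq_zero_of_notMem_tsupport h]
  rfl

/-- The integrand `F div_μ X + dF · X`, that is, the divergence of `F X`. -/
def divergenceSmul (μ : VolumeForm n M) (X : VField n M) (F : M → ℝ) (x : M) : ℝ :=
  F x * divergence μ X x + differential F x (X x)

lemma continuous_divergenceSmul (hF : ContMDiff (𝓡 n) 𝓘(ℝ, ℝ) ∞ F)
    (hX : ∀ p : M, ContDiffOn ℝ ∞ (fieldInChart X p) (extChartAt (𝓡 n) p).target) :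
    Continuous (divergenceSmul μ X F) :=
  (hF.continuous.mul (continuous_divergence hX)).add (continuous_differential_apply hF hX)

omit [IsManifold (𝓡 n) ∞ M] in
lemma support_divergenceSmul_subset :
    Function.support (divergenceSmul μ X F) ⊆ tsupport F := by
  intro x hx
  by_contra h
  refine hx ?_
  rw [divergenceSmul, image_eq_zero_of_notMem_tsupport h, differential_eq_zero_of_notMem_tsupport h,
    zero_mul, zero_add]
  rfl

omit [IsManifold (𝓡 n) ∞ M] in
lemma tsupport_divergenceSmul_subset : tsupport (divergenceSmul μ X F) ⊆ tsupport F :=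
  closure_minimal support_divergenceSmul_subset (isClosed_tsupport F)

omit [IsManifold (𝓡 n) ∞ M] in
lemma hasCompactSupport_divergenceSmul (hFc : HasCompactSupport F) :
    HasCompactSupport (divergenceSmul μ X F) :=
  hFc.mono' support_divergenceSmul_subset

/-- Charts need not be positively oriented. A continuous nowhere vanishing density has locally
constant sign, so `|ρ|` is locally `ε ρ` with `ε = ±1`; it is therefore smooth and can be
differentiated like `ρ`. -/
lemma exists_abs_chartDensity_eventuallyEq (μ : VolumeForm n M) {q : M} {y : Model n}
    (hy : y ∈ (extChartAt (𝓡 n) q).target) :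
    ∃ ε : ℝ, ∀ᶠ z in 𝓝 y, |chartDensity μ q z| = ε * chartDensity μ q z := by
  have hc : ContinuousAt (chartDensity μ q) y :=
    (contDiffOn_chartDensity μ q).continuousOn.continuousAt
      ((isOpen_extChartAt_target q).mem_nhds hy)
  rcases lt_or_gt_of_ne (chartDensity_ne_zero μ hy) with h | h
  · refine ⟨-1, ?_⟩
    filter_upwards [hc.eventually_lt continuousAt_const h] with z hz
    rw [abs_of_neg hz, neg_one_mul]
  · refine ⟨1, ?_⟩
    filter_upwards [continuousAt_const.eventually_lt hc h] with z hz
    rw [abs_of_pos hz, one_mul]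

lemma contDiffOn_mul_abs_density (hF : ContMDiff (𝓡 n) 𝓘(ℝ, ℝ) ∞ F)
    (hX : ∀ p : M, ContDiffOn ℝ ∞ (fieldInChart X p) (extChartAt (𝓡 n) p).target) (q : M)
    (i : Fin n) : ContDiffOn ℝ ∞
      (fun z => funInChart F q z * (|chartDensity μ q z| * fieldInChart X q z i))
      (extChartAt (𝓡 n) q).target := by
  intro y hy
  have hn := (isOpen_extChartAt_target (I := 𝓡 n) q).mem_nhds hy
  obtain ⟨ε, hε⟩ := exists_abs_chartDensity_eventuallyEq μ hy
  refine ContDiffAt.contDiffWithinAt (ContDiffAt.congr_of_eventuallyEq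
    (f := fun z => funInChart F q z * (ε * (chartDensity μ q z * fieldInChart X q z i))) ?_ ?_)
  · exact ((contDiffOn_funInChart hF q).contDiffAt hn).mul
      (contDiffAt_const.mul ((contDiffOn_density_mul_coord hX q i).contDiffAt hn))
  · filter_upwards [hε] with z hz
    rw [hz, mul_assoc]

/-- Leibniz rule for `F · (ε ρ Xⁱ)`: differentiating the second factor produces `F div_μ X`, and
differentiating `F` produces `dF · X`. -/
lemma divergenceSmul_mul_density (hF : ContMDiff (𝓡 n) 𝓘(ℝ, ℝ) ∞ F)
    (hX : ∀ p : M, ContDiffOn ℝ ∞ (fieldInChart X p) (extChartAt (𝓡 n) p).target) {q : M}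
    {y : Model n} (hy : y ∈ (extChartAt (𝓡 n) q).target) :
    divergenceSmul μ X F ((extChartAt (𝓡 n) q).symm y) * |chartDensity μ q y| =
      ∑ i, fderiv ℝ (fun z => funInChart F q z *
        (|chartDensity μ q z| * fieldInChart X q z i)) y (stdFrame n i) := by
  have hn := (isOpen_extChartAt_target (I := 𝓡 n) q).mem_nhds hy
  obtain ⟨ε, hε⟩ := exists_abs_chartDensity_eventuallyEq μ hy
  have hFd : DifferentiableAt ℝ (funInChart F q) y :=
    ((contDiffOn_funInChart hF q).contDiffAt hn).differentiableAt (by simp)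
  have hterm (i : Fin n) : fderiv ℝ (fun z => funInChart F q z *
      (|chartDensity μ q z| * fieldInChart X q z i)) y (stdFrame n i) =
        ε * (funInChart F q y * fderiv ℝ (fun z => chartDensity μ q z * fieldInChart X q z i) y
          (stdFrame n i)) + ε * chartDensity μ q y *
            (fieldInChart X q y i * fderiv ℝ (funInChart F q) y (stdFrame n i)) := by
    have hW : DifferentiableAt ℝ (fun z => chartDensity μ q z * fieldInChart X q z i) y :=
      ((contDiffOn_density_mul_coord hX q i).contDiffAt hn).differentiableAt (by simp)
    have heq : (fun z => funInChart F q z * (|chartDensity μ q z| * fieldInChart X q z i)) =ᶠ[𝓝 y]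
        fun z => funInChart F q z * (ε * (chartDensity μ q z * fieldInChart X q z i)) := by
      filter_upwards [hε] with z hz
      rw [hz, mul_assoc]
    rw [heq.fderiv_eq, fderiv_fun_mul hFd (hW.const_mul ε), fderiv_const_mul hW]
    simp only [add_apply, smul_apply, smul_eq_mul]
    ring
  simp_rw [hterm]
  rw [Finset.sum_add_distrib, ← Finset.mul_sum, ← Finset.mul_sum, ← Finset.mul_sum,
    ← divergence_mul_chartDensity μ X hX hy, hε.self_of_nhds, divergenceSmul,
    differential_apply_field hF X hy]
  have hsum : ∑ i, fieldInChart X q y i * fderiv ℝ (funInChart F q) y (stdFrame n i) =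
      fderiv ℝ (funInChart F q) y (fieldInChart X q y) := by
    conv_rhs => rw [eq_sum_coord_smul_stdFrame (fieldInChart X q y), map_sum]
    simp only [map_smul, smul_eq_mul]
  rw [hsum, funInChart]
  ring

variable [T2Space M] [ParacompactSpace M] [MeasurableSpace M] [BorelSpace M]

/-- In a single chart the integrand is a sum of partial derivatives of functions that extend by zero
to smooth compactly supported functions on `ℝⁿ`. -/
lemma integral_divergenceSmul_of_tsupport_subset (hF : ContMDiff (𝓡 n) 𝓘(ℝ, ℝ) ∞ F)
    (hFc : HasCompactSupport F)
    (hX : ∀ p : M, ContDiffOn ℝ ∞ (fieldInChart X p) (extChartAt (𝓡 n) p).target) {q : M}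
    (hq : tsupport F ⊆ (extChartAt (𝓡 n) q).source) :
    ∫ x, divergenceSmul μ X F x ∂(volumeMeasure μ) = 0 := by
  rw [integral_volumeMeasure_eq_setIntegral μ (continuous_divergenceSmul hF hX)
    (hasCompactSupport_divergenceSmul hFc) (tsupport_divergenceSmul_subset.trans hq)]
  set U := (extChartAt (𝓡 n) q).target
  have hU : IsOpen U := isOpen_extChartAt_target q
  set w : Fin n → Model n → ℝ := fun i z =>
    funInChart F q z * (|chartDensity μ q z| * fieldInChart X q z i)
  have hK := isCompact_image_chart hFc.isCompact hq
  have hKU := image_chart_subset_target hq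
  have h0 (i : Fin n) : ∀ y ∈ U \ extChartAt (𝓡 n) q '' tsupport F, w i y = 0 := fun y hy => by
    simp only [w, funInChart]
    rw [eq_zero_of_notMem_image_chart hy, zero_mul]
  have hw (i : Fin n) : ContDiff ℝ 1 (U.indicator (w i)) :=
    (contDiff_indicator_of_isCompact hU hK hKU (contDiffOn_mul_abs_density hF hX q i)
      (h0 i)).of_le (by simp)
  have hwc (i : Fin n) : HasCompactSupport (U.indicator (w i)) :=
    hasCompactSupport_indicator hK (h0 i)
  have hsub (i : Fin n) : tsupport (U.indicator (w i)) ⊆ U := by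
    refine (closure_minimal (fun y hy => ?_) hK.isClosed).trans hKU
    by_contra h
    refine hy ?_
    by_cases hyU : y ∈ U
    · rw [indicator_of_mem hyU, h0 i y ⟨hyU, h⟩]
    · exact indicator_of_notMem hyU _
  calc _ = ∫ y in U, ∑ i, fderiv ℝ (U.indicator (w i)) y (stdFrame n i) := by
        refine setIntegral_congr_fun hU.measurableSet fun y hy => ?_
        refine (divergenceSmul_mul_density hF hX hy).trans (Finset.sum_congr rfl fun i _ => ?_)
        have : U.indicator (w i) =ᶠ[𝓝 y] w i := by
          filter_upwards [hU.mem_nhds hy] with z hz using indicator_of_mem hz _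
        rw [this.fderiv_eq]
    _ = ∫ y, ∑ i, fderiv ℝ (U.indicator (w i)) y (stdFrame n i) := by
        -- The closed supports of the extensions lie in `U`, so their derivatives vanish outside
        -- `U`.
        refine setIntegral_eq_integral_of_forall_compl_eq_zero fun y hy => ?_
        refine Finset.sum_eq_zero fun i _ => ?_
        rw [fderiv_of_notMem_tsupport ℝ fun h => hy (hsub i h)]
        rfl
    _ = 0 := by
        rw [integral_finsetSum _ fun i _ => integrable_fderiv_apply (hw i) (hwc i) _]
        exact Finset.sum_eq_zero fun i _ => integral_fderiv_eq_zero (hw i) (hwc i) _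

/-- The divergence theorem: `∫ (F div_μ X + dF · X) = 0` for `F` with compact support. -/
lemma integral_divergenceSmul (hF : ContMDiff (𝓡 n) 𝓘(ℝ, ℝ) ∞ F) (hFc : HasCompactSupport F)
    (hX : ∀ p : M, ContDiffOn ℝ ∞ (fieldInChart X p) (extChartAt (𝓡 n) p).target) :
    ∫ x, divergenceSmul μ X F x ∂(volumeMeasure μ) = 0 := by
  -- The partition of unity defining the measure is only continuous, so `F` is cut up by smooth bump
  -- functions instead. By induction on a finite set of them, `F` splits as `F f_c + F (1 - f_c)`:
  -- the first part lives in one chart, the second needs one bump function fewer.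
  let f (c : M) : SmoothBumpFunction (𝓡 n) c := Classical.arbitrary _
  have key (s : Finset M) : ∀ F : M → ℝ, ContMDiff (𝓡 n) 𝓘(ℝ, ℝ) ∞ F → HasCompactSupport F →
      (∀ x, F x ≠ 0 → ∃ c ∈ s, f c x = 1) →
        ∫ x, divergenceSmul μ X F x ∂(volumeMeasure μ) = 0 := by
    classical
    induction s using Finset.induction_on with
    | empty =>
      intro F _ _ h
      have hF0 : F = fun _ => 0 := by
        funext x
        by_contra hx
        obtain ⟨c, hc, _⟩ := h x hx
        simp at hc
      have (x : M) : divergenceSmul μ X F x = 0 := by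
        by_contra hx
        have := support_divergenceSmul_subset hx
        rw [hF0] at this
        simp at this
      simp [this]
    | insert c s _ ih =>
      intro F hF hFc h
      have h1 : ContMDiff (𝓡 n) 𝓘(ℝ, ℝ) ∞ (fun x => F x * f c x) := hF.mul (f c).contMDiff
      have h2 : ContMDiff (𝓡 n) 𝓘(ℝ, ℝ) ∞ (fun x => F x * (1 - f c x)) :=
        hF.mul (contMDiff_const.sub (f c).contMDiff)
      have h1c : HasCompactSupport (fun x => F x * f c x) := hFc.mul_right
      have h2c : HasCompactSupport (fun x => F x * (1 - f c x)) := hFc.mul_right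
      have hadd (x : M) : divergenceSmul μ X F x = divergenceSmul μ X (fun x => F x * f c x) x +
          divergenceSmul μ X (fun x => F x * (1 - f c x)) x := by
        have hsum : F = (fun x => F x * f c x) + fun x => F x * (1 - f c x) := by
          funext x; simp only [Pi.add_apply]; ring
        have hd := mfderiv_add (I := 𝓡 n) ((h1 x).mdifferentiableAt (by simp))
          ((h2 x).mdifferentiableAt (by simp))
        rw [← hsum] at hd
        have hd' : differential F x (X x) = differential (fun x => F x * f c x) x (X x) +
            differential (fun x => F x * (1 - f c x)) x (X x) :=
          congrArg (fun A : Model n →L[ℝ] ℝ => A (X x)) hd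
        simp only [divergenceSmul, hd']
        ring
      simp_rw [hadd]
      rw [integral_add
        ((continuous_divergenceSmul h1 hX).integrable_of_hasCompactSupport
          (hasCompactSupport_divergenceSmul h1c))
        ((continuous_divergenceSmul h2 hX).integrable_of_hasCompactSupport
          (hasCompactSupport_divergenceSmul h2c)),
        integral_divergenceSmul_of_tsupport_subset (q := c) h1 h1c hX ?_, ih _ h2 h2c ?_, add_zero]
      · intro x hx
        obtain ⟨c', hc', hc1⟩ := h x (left_ne_zero_of_mul hx)
        -- Where `f c = 1` the factor `1 - f c` is zero, so such points do not lie in the support of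
        -- the second part.
        rcases Finset.mem_insert.1 hc' with rfl | hs
        · exact absurd hx (by simp [hc1])
        · exact ⟨c', hs, hc1⟩
      · rw [extChartAt_source]
        exact (closure_mono (Function.support_mul_subset_right F (f c))).trans
          (f c).tsupport_subset_chartAt_source
  -- Each bump function equals `1` near its centre, so by compactness finitely many of the sets `f c
  -- = 1` cover the support of `F`.
  obtain ⟨s, _, hs⟩ := hFc.isCompact.elim_nhds_subcover (fun c => {x | f c x = 1})
    fun c _ => (f c).eventuallyEq_one
  refine key s F hF hFc fun x hx => ?_
  simpa using hs (subset_tsupport F hx)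

variable (μ) in
/-- Integration by parts on a manifold with a volume form. -/
theorem integral_mul_divergence (hF : ContMDiff (𝓡 n) 𝓘(ℝ, ℝ) ∞ F) (hFc : HasCompactSupport F)
    (hX : ∀ p : M, ContDiffOn ℝ ∞ (fieldInChart X p) (extChartAt (𝓡 n) p).target) :
    ∫ x, F x * divergence μ X x ∂(volumeMeasure μ) =
      - ∫ x, differential F x (X x) ∂(volumeMeasure μ) := by
  have h := integral_divergenceSmul (μ := μ) hF hFc hX
  simp only [divergenceSmul] at h
  rw [integral_add (f := fun x => F x * divergence μ X x) ((hF.continuous.mul (continuous_divergence hX)).integrable_of_hasCompactSupport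
    hFc.mul_right) ((continuous_differential_apply hF hX).integrable_of_hasCompactSupport
      (hFc.mono' ((subset_tsupport _).trans tsupport_differential_apply_subset)))] at h
  linarith

end DivergenceTheorem

/-! ### Compact support of the Laplacians and the two integral identities -/

section Laplacians

variable {n : ℕ} {M : Type*} [TopologicalSpace M] [ChartedSpace (Model n) M]
  [IsManifold (𝓡 n) ∞ M] {X : VField n M}

/-- The coordinate formula for the divergence sees only the germ of the field. Hence the Laplacians
of a function vanish outside its closed support. -/
lemma divergence_eq_zero_of_eventually_eq_zero (μ : VolumeForm n M)
    (hX : ∀ p : M, ContDiffOn ℝ ∞ (fieldInChart X p) (extChartAt (𝓡 n) p).target) {x : M}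
    (h : ∀ᶠ z in 𝓝 x, X z = 0) : divergence μ X x = 0 := by
  have hy := mem_extChartAt_target (I := 𝓡 n) x
  have hdiv := divergence_mul_chartDensity μ X hX hy
  have hc : ContinuousAt (extChartAt (𝓡 n) x).symm (extChartAt (𝓡 n) x x) :=
    continuousAt_extChartAt_symm x
  rw [ContinuousAt, extChartAt_to_inv] at hc
  have hz (i : Fin n) : (fun z => chartDensity μ x z * fieldInChart X x z i)
      =ᶠ[𝓝 (extChartAt (𝓡 n) x x)] fun _ => 0 := by
    filter_upwards [hc.eventually h] with z hz
    have hz' : fieldAt X ((extChartAt (𝓡 n) x).symm z) = 0 := hz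
    rw [fieldInChart_eq, hz', map_zero]
    simp
  rw [Finset.sum_eq_zero fun i _ => by rw [(hz i).fderiv_eq]; simp, extChartAt_to_inv] at hdiv
  exact (mul_eq_zero.1 hdiv).resolve_right (chartDensity_ne_zero μ hy)

variable (b : GeometricStructure n M) (μ : VolumeForm n M) {F G : M → ℝ}

lemma leftGradient_eq_zero {x : M} (hx : x ∉ tsupport G) : leftGradient b G x = 0 :=
  b.nondegenerate_left x _ fun w => by
    rw [leftGradient_spec, differential_eq_zero_of_notMem_tsupport hx]; rfl

lemma rightGradient_eq_zero {x : M} (hx : x ∉ tsupport G) : rightGradient b G x = 0 :=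
  b.nondegenerate_right x _ fun w => by
    rw [rightGradient_spec, differential_eq_zero_of_notMem_tsupport hx]; rfl

lemma hasCompactSupport_leftLaplacian (hG : ContMDiff (𝓡 n) 𝓘(ℝ, ℝ) ∞ G)
    (hGc : HasCompactSupport G) : HasCompactSupport (leftLaplacian b μ G) := by
  refine hGc.mono' fun x hx => ?_
  by_contra h
  refine hx (divergence_eq_zero_of_eventually_eq_zero μ (contDiffOn_leftGradient b hG) ?_)
  filter_upwards [(isClosed_tsupport G).isOpen_compl.mem_nhds h] with z hz
  exact leftGradient_eq_zero b hz

lemma hasCompactSupport_rightLaplacian (hG : ContMDiff (𝓡 n) 𝓘(ℝ, ℝ) ∞ G)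
    (hGc : HasCompactSupport G) : HasCompactSupport (rightLaplacian b μ G) := by
  refine hGc.mono' fun x hx => ?_
  by_contra h
  refine hx (divergence_eq_zero_of_eventually_eq_zero μ (contDiffOn_rightGradient b hG) ?_)
  filter_upwards [(isClosed_tsupport G).isOpen_compl.mem_nhds h] with z hz
  exact rightGradient_eq_zero b hz

lemma continuous_leftLaplacian (hG : ContMDiff (𝓡 n) 𝓘(ℝ, ℝ) ∞ G) :
    Continuous (leftLaplacian b μ G) :=
  continuous_divergence (contDiffOn_leftGradient b hG)

lemma continuous_rightLaplacian (hG : ContMDiff (𝓡 n) 𝓘(ℝ, ℝ) ∞ G) :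
    Continuous (rightLaplacian b μ G) :=
  continuous_divergence (contDiffOn_rightGradient b hG)

lemma bracket_eq_differential_leftGradient (F G : M → ℝ) :
    bracket b F G = fun x => differential F x (leftGradient b G x) :=
  funext fun x => leftGradient_spec b F x _

/-- The right gradient sits in the second slot of `b`; testing the one of `F` against the one of `G`
therefore yields the bracket in reversed order. -/
lemma bracket_eq_differential_rightGradient (F G : M → ℝ) :
    bracket b G F = fun x => differential F x (rightGradient b G x) :=
  funext fun x => (bracket_eq_right b G F x).trans (rightGradient_spec b F x _)

variable [T2Space M] [ParacompactSpace M] [MeasurableSpace M] [BorelSpace M]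

lemma integrable_bracket (hF : ContMDiff (𝓡 n) 𝓘(ℝ, ℝ) ∞ F) (hFc : HasCompactSupport F)
    (hG : ContMDiff (𝓡 n) 𝓘(ℝ, ℝ) ∞ G) : Integrable (bracket b F G) (volumeMeasure μ) := by
  rw [bracket_eq_differential_leftGradient]
  exact (continuous_differential_apply hF
    (contDiffOn_leftGradient b hG)).integrable_of_hasCompactSupport
      (hFc.mono' ((subset_tsupport _).trans tsupport_differential_apply_subset))

lemma integral_mul_leftLaplacian (hF : ContMDiff (𝓡 n) 𝓘(ℝ, ℝ) ∞ F) (hFc : HasCompactSupport F)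
    (hG : ContMDiff (𝓡 n) 𝓘(ℝ, ℝ) ∞ G) :
    ∫ x, F x * leftLaplacian b μ G x ∂(volumeMeasure μ) =
      - ∫ x, bracket b F G x ∂(volumeMeasure μ) := by
  rw [bracket_eq_differential_leftGradient]
  exact integral_mul_divergence μ hF hFc (contDiffOn_leftGradient b hG)

lemma integral_mul_rightLaplacian (hF : ContMDiff (𝓡 n) 𝓘(ℝ, ℝ) ∞ F) (hFc : HasCompactSupport F)
    (hG : ContMDiff (𝓡 n) 𝓘(ℝ, ℝ) ∞ G) :
    ∫ x, F x * rightLaplacian b μ G x ∂(volumeMeasure μ) =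
      - ∫ x, bracket b G F x ∂(volumeMeasure μ) := by
  rw [bracket_eq_differential_rightGradient]
  exact integral_mul_divergence μ hF hFc (contDiffOn_rightGradient b hG)

end Laplacians

/-! ### Inner products in `L²` and the final assembly -/

lemma inner_toLp_eq_integral {α : Type*} [MeasurableSpace α] {ν : Measure α} {f g : α → ℝ}
    (hf : MemLp f 2 ν) (hg : MemLp g 2 ν) :
    inner ℝ (hf.toLp f) (hg.toLp g) = ∫ x, g x * f x ∂ν := by
  rw [L2.inner_def]
  refine integral_congr_ae ?_
  filter_upwards [hf.coeFn_toLp, hg.coeFn_toLp] with x h1 h2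
  rw [h1, h2]
  simp [mul_comm]

end GeometricManifold

end

open GeometricManifold in
theorem theorem5p2 {n : ℕ} {M : Type*} [TopologicalSpace M] [ChartedSpace (Model n) M]
    [IsManifold (𝓡 n) ∞ M] [T2Space M] [ParacompactSpace M] [ConnectedSpace M]
    [MeasurableSpace M] [BorelSpace M]
    (μ : VolumeForm n M) (b : GeometricStructure n M) (F G : M → ℝ)
    (hF : ContMDiff (𝓡 n) 𝓘(ℝ, ℝ) ∞ F) (hFc : HasCompactSupport F)
    (hG : ContMDiff (𝓡 n) 𝓘(ℝ, ℝ) ∞ G) (hGc : HasCompactSupport G) :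
    -- all integrals below converge
    (Integrable (fun x => F x * leftLaplacian b μ G x) (volumeMeasure μ) ∧
      Integrable (fun x => F x * rightLaplacian b μ G x) (volumeMeasure μ) ∧
      Integrable (bracket b F G) (volumeMeasure μ) ∧
      Integrable (bracket b G F) (volumeMeasure μ) ∧
      Integrable (fun x => G x * rightLaplacian b μ F x) (volumeMeasure μ)) ∧
    -- (i)
    ∫ x, F x * leftLaplacian b μ G x ∂(volumeMeasure μ) =
      - ∫ x, bracket b F G x ∂(volumeMeasure μ) ∧
    -- (ii)
    ∫ x, F x * rightLaplacian b μ G x ∂(volumeMeasure μ) =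
      - ∫ x, bracket b G F x ∂(volumeMeasure μ) ∧
    -- (iii)
    ∃ (hF2 : MemLp F 2 (volumeMeasure μ)) (hG2 : MemLp G 2 (volumeMeasure μ))
      (hLG2 : MemLp (leftLaplacian b μ G) 2 (volumeMeasure μ))
      (hRF2 : MemLp (rightLaplacian b μ F) 2 (volumeMeasure μ)),
      inner ℝ (hLG2.toLp (leftLaplacian b μ G)) (hF2.toLp F) =
        ∫ x, F x * leftLaplacian b μ G x ∂(volumeMeasure μ) ∧
      ∫ x, F x * leftLaplacian b μ G x ∂(volumeMeasure μ) =
        ∫ x, G x * rightLaplacian b μ F x ∂(volumeMeasure μ) ∧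
      ∫ x, G x * rightLaplacian b μ F x ∂(volumeMeasure μ) =
        inner ℝ (hG2.toLp G) (hRF2.toLp (rightLaplacian b μ F)) := by
  have hFL : MemLp F 2 (volumeMeasure μ) := hF.continuous.memLp_of_hasCompactSupport hFc
  have hGL : MemLp G 2 (volumeMeasure μ) := hG.continuous.memLp_of_hasCompactSupport hGc
  have hLG : MemLp (leftLaplacian b μ G) 2 (volumeMeasure μ) :=
    (continuous_leftLaplacian b μ hG).memLp_of_hasCompactSupport
      (hasCompactSupport_leftLaplacian b μ hG hGc)
  have hRF : MemLp (rightLaplacian b μ F) 2 (volumeMeasure μ) :=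
    (continuous_rightLaplacian b μ hF).memLp_of_hasCompactSupport
      (hasCompactSupport_rightLaplacian b μ hF hFc)
  refine ⟨⟨?_, ?_, ?_, ?_, ?_⟩, ?_, ?_, hFL, hGL, hLG, hRF, ?_, ?_, ?_⟩
  · exact (hF.continuous.mul (continuous_leftLaplacian b μ hG)).integrable_of_hasCompactSupport
      hFc.mul_right
  · exact (hF.continuous.mul (continuous_rightLaplacian b μ hG)).integrable_of_hasCompactSupport
      hFc.mul_right
  · exact integrable_bracket b μ hF hFc hG
  · exact integrable_bracket b μ hG hGc hF
  · exact (hG.continuous.mul (continuous_rightLaplacian b μ hF)).integrable_of_hasCompactSupport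
      hGc.mul_right
  · exact integral_mul_leftLaplacian b μ hF hFc hG
  · exact integral_mul_rightLaplacian b μ hF hFc hG
  · exact inner_toLp_eq_integral hLG hFL
  -- Both sides equal `-∫ {F, G}_b`: the left one by the first identity, the right one by the second
  -- with `F` and `G` exchanged.
  · rw [integral_mul_leftLaplacian b μ hF hFc hG, integral_mul_rightLaplacian b μ hG hGc hF]
  · rw [inner_toLp_eq_integral]
    exact integral_congr_ae (Filter.Eventually.of_forall fun x => mul_comm _ _)
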